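/- All graphs are finite and simple; $\overline G$ denotes the complement of $G$. A graph is \emph{perfect} if every induced subgraph has chromatic number equal to the size of its largest clique; it is \emph{Berge} if every induced cycle of length greater than $3$ in $G$ or in $\overline G$ has even length. A \emph{minimum imperfect graph} is a Berge graph that is not perfect and has the smallest number of vertices among all Berge graphs that are not perfect. A \emph{path} in $G$ is an induced path, and an \emph{antipath} in $G$ is an induced path of $\overline G$; its length is the number of edges of that path, it is odd if its length is odd, and its interior is the set of its vertices other than its ends. A set $X\subseteq V(G)$ is \emph{connected} if it induces a connected subgraph of $G$ (so $\emptyset$ is connected), and \emph{anticonnected} if it is connected in $\overline G$. A \emph{component} of a nonempty set $X$ is a maximal connected subset of $X$, and an \emph{anticomponent} of $X$ is a maximal anticonnected subset of $X$. A \emph{skew partition} of $G$ is a partition $(A,B)$ of $V(G)$ such that $A$ is not connected and $B$ is not anticonnected. It is \emph{balanced} if there is no odd path between nonadjacent vertices of $B$ with interior in $A$, and no odd antipath between adjacent vertices of $A$ with interior in $B$. It is \emph{loose} if some vertex of $B$ has no neighbour in some component of $A$, or some vertex of $A$ is adjacent to every vertex of some anticomponent of $B$. Let $A_1,\dots,A_m$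 be the components of $A$ and $B_1,\dots,B_n$ the anticomponents of $B$. Then $(i,j)$ is a \emph{path pair} if there is an odd path in $G$ with ends nonadjacent vertices of $B_j$ and with interior in $A_i$, and an \emph{antipath pair} if there is an odd antipath in $G$ with ends adjacent vertices of $A_i$ and with interior in $B_j$. \textbf{Theorem.} Let $G$ be a minimum imperfect graph. \begin{enumerate} \item Let $(A,B)$ be a skew partition of $G$, with components $A_1,\dots,A_m$ of $A$ and anticomponents $B_1,\dots,B_n$ of $B$. For every $i\in\{1,\dots,m\}$ there is $j\in\{1,\dots,n\}$ such that $(i,j)$ is a path pair or an antipath pair, and for every $j\in\{1,\dots,n\}$ there is $i\in\{1,\dots,m\}$ such that $(i,j)$ is a path pair or an antipath pair. \item Consequently, no skew partition of $G$ is balanced. \item No skew partition of $G$ is loose. \end{enumerate} -/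

import Mathlib

namespace SimpleGraph

variable {V : Type*}

/-- A graph is perfect if every induced subgraph has chromatic number equal to the size of
its largest clique. -/
def IsPerfectGraph (G : SimpleGraph V) : Prop :=
  ∀ S : Set V, (G.induce S).chromaticNumber = ((G.induce S).cliqueNum : ℕ∞)

/-- `G` has a hole of length `n`: an induced subgraph that is a cycle of length `n > 3`. -/
def HasHole (G : SimpleGraph V) (n : ℕ) : Prop :=
  3 < n ∧ Nonempty (cycleGraph n ↪g G)

/-- `G` has an antihole of length `n`: a hole of the complement. -/
def HasAntihole (G : SimpleGraph V) (n : ℕ) : Prop :=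
  Gᶜ.HasHole n

/-- A graph is Berge if all its holes and antiholes have even length. -/
def IsBerge (G : SimpleGraph V) : Prop :=
  ∀ n : ℕ, (G.HasHole n → Even n) ∧ (G.HasAntihole n → Even n)

/-- A minimum imperfect graph: a finite Berge graph that is not perfect, with the smallest number
of vertices among all such graphs (up to isomorphism, every finite graph lives on some `Fin m`). -/
def IsMinimumImperfect [Fintype V] (G : SimpleGraph V) : Prop :=
  G.IsBerge ∧ ¬ G.IsPerfectGraph ∧
    ∀ (m : ℕ) (H : SimpleGraph (Fin m)), H.IsBerge → ¬ H.IsPerfectGraph → Fintype.card V ≤ m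

/-- A vertex set is connected if it induces a connected graph; the empty set counts as connected. -/
def IsConnectedSet (G : SimpleGraph V) (X : Set V) : Prop :=
  (G.induce X).Preconnected

/-- A vertex set is anticonnected if it is connected in the complement graph. -/
def IsAnticonnectedSet (G : SimpleGraph V) (X : Set V) : Prop :=
  Gᶜ.IsConnectedSet X

/-- `C` is a component of the nonempty set `A`: a maximal connected subset of it. -/
def IsComponent (G : SimpleGraph V) (A C : Set V) : Prop :=
  A.Nonempty ∧ Maximal (fun X => X ⊆ A ∧ G.IsConnectedSet X) C

/-- `D` is an anticomponent of the nonempty set `B`: a maximal anticonnected subset of it. -/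
def IsAnticomponent (G : SimpleGraph V) (B D : Set V) : Prop :=
  B.Nonempty ∧ Maximal (fun X => X ⊆ B ∧ G.IsAnticonnectedSet X) D

/-- A skew partition: a partition `(A, B)` of the vertex set with `A` not connected and `B` not
anticonnected. -/
def IsSkewPartition (G : SimpleGraph V) (A B : Set V) : Prop :=
  Disjoint A B ∧ A ∪ B = Set.univ ∧ ¬ G.IsConnectedSet A ∧ ¬ G.IsAnticonnectedSet B

/-- There is an induced path of length `n` (that is, with `n` edges) in `G` with ends `u` and `v`
and with all its internal vertices in `X`. -/
def HasInducedPath (G : SimpleGraph V) (n : ℕ) (u v : V) (X : Set V) : Prop :=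
  ∃ p : pathGraph (n + 1) ↪g G, p 0 = u ∧ p (Fin.last n) = v ∧
    ∀ i : Fin (n + 1), i ≠ 0 → i ≠ Fin.last n → p i ∈ X

/-- There is an antipath of length `n` in `G` (an induced path of the complement) with ends `u`
and `v` and with all its internal vertices in `X`. -/
def HasAntipath (G : SimpleGraph V) (n : ℕ) (u v : V) (X : Set V) : Prop :=
  Gᶜ.HasInducedPath n u v X

/-- There is an odd path with ends nonadjacent vertices of `Y` and with interior in `X`. When `X`
is a component of `A` and `Y` an anticomponent of `B`, this says that they form a path pair. -/
def IsPathPair (G : SimpleGraph V) (X Y : Set V) : Prop :=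
  ∃ u ∈ Y, ∃ v ∈ Y, ¬ G.Adj u v ∧ ∃ n : ℕ, Odd n ∧ G.HasInducedPath n u v X

/-- There is an odd antipath with ends adjacent vertices of `X` and with interior in `Y`. When `X`
is a component of `A` and `Y` an anticomponent of `B`, this says that they form an antipath
pair. -/
def IsAntipathPair (G : SimpleGraph V) (X Y : Set V) : Prop :=
  ∃ u ∈ X, ∃ v ∈ X, G.Adj u v ∧ ∃ n : ℕ, Odd n ∧ G.HasAntipath n u v Y

/-- The pair `(A, B)` is balanced: there is no odd path between nonadjacent vertices of `B` with
interior in `A`, and no odd antipath between adjacent vertices of `A` with interior in `B`. -/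
def IsBalancedPair (G : SimpleGraph V) (A B : Set V) : Prop :=
  (∀ u ∈ B, ∀ v ∈ B, ¬ G.Adj u v → ∀ n : ℕ, Odd n → ¬ G.HasInducedPath n u v A) ∧
  (∀ u ∈ A, ∀ v ∈ A, G.Adj u v → ∀ n : ℕ, Odd n → ¬ G.HasAntipath n u v B)

/-- The pair `(A, B)` is loose: some vertex of `B` has no neighbour in some component of `A`, or
some vertex of `A` is complete to some anticomponent of `B`. -/
def IsLoosePair (G : SimpleGraph V) (A B : Set V) : Prop :=
  (∃ b ∈ B, ∃ C, G.IsComponent A C ∧ ∀ a ∈ C, ¬ G.Adj b a) ∨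
  (∃ a ∈ A, ∃ D, G.IsAnticomponent B D ∧ ∀ b ∈ D, G.Adj a b)

end SimpleGraph

/-! Perfection is handled through multisets of stable sets: in a perfect graph every clique bound
`k` is realised by a cover with `k` stable sets. Lovász's replication argument extends this to
integer weights (`PerfectOn.exists_stableCover`) and yields the perfect graph theorem
(`PerfectOn.compl`). Hence complements of minimum imperfect graphs are minimum imperfect, and only
one of each pair of dual statements needs a proof.

Pairs. Suppose a component `C` of `A` is in no pair. Ends of an odd path between nonadjacent
vertices of `B` share an anticomponent, and the interior of an odd antipath between adjacent
vertices of `C` lies in one, so `(C, B)` is balanced. Split `B` into `D` and `E`, complete to each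
other. Balance makes `C ∪ B` plus a new vertex with neighbourhood `D` (or `E`) Berge
(`bergeOn_addStar`). If `A \ C` has at least two vertices, this graph is smaller than `G`, hence
perfect. Replicating the new vertex makes the `C` side follow the division of colours between `D`
and `E` found in a cover of `(A \ C) ∪ B`. So `V` splits into two proper subsets whose clique bounds
add up to that of `G`; covering each one covers `G` (`not_balanced_part`). If `A \ C` is a single
vertex, it is the centre of a star cutset of the complement, which `no_star_cutset` forbids.

Loose partitions. Looseness gives a vertex `v` anticomplete to a component `C` and complete to an
anticomponent `D`; take `|C| + |D|` least. Then every vertex of `D` has a neighbour in `C` and every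
vertex of `C` a nonneighbour in `D`, since an exception could be moved across the partition. Through
`v`, the sets `C`, `D` form no pair, and the minimality rules out antipath pairs of `C` and path
pairs of `D`. The pair theorem therefore yields an odd path with interior in `C` and ends complete
to `D`, and an odd antipath with interior in `D` and ends anticomplete to `C`. A parity argument in
the style of Roussel and Rubio (`IsPathAntipathMatrix.not_odd`) shows that the two cannot coexist.
-/

namespace SimpleGraph

/-! ### Stable covers, replication and the perfect graph theorem. -/

section Covers

variable {V : Type*}

/-- Every clique contained in `S` has at most `k` vertices. -/
def CliqueBound (G : SimpleGraph V) (S : Set V) (k : ℕ) : Prop :=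
  ∀ t : Finset V, ↑t ⊆ S → G.IsClique t → t.card ≤ k

open Classical in
/-- `m` consists of stable sets, and every vertex `v` is in at least `w v` of them. -/
def IsStableCover (G : SimpleGraph V) (w : V → ℕ) (m : Multiset (Finset V)) : Prop :=
  (∀ F ∈ m, G.IsIndepSet F) ∧ ∀ v, w v ≤ m.countP (v ∈ ·)

open Classical in
/-- The weight that is `1` on `S` and `0` elsewhere. -/
noncomputable def setWeight (S : Set V) (v : V) : ℕ := if v ∈ S then 1 else 0

/-- Every clique bound on a subset of `S` is the size of a stable cover. -/
def PerfectOn (G : SimpleGraph V) (S : Set V) : Prop :=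
  ∀ T ⊆ S, ∀ k, G.CliqueBound T k → ∃ m, G.IsStableCover (setWeight T) m ∧ m.card = k

theorem CliqueBound.mono {G : SimpleGraph V} {S T : Set V} {k l : ℕ} (h : G.CliqueBound S k)
    (hT : T ⊆ S) (hk : k ≤ l) : G.CliqueBound T l :=
  fun t ht hc => (h t (ht.trans hT) hc).trans hk

theorem CliqueBound.union {G : SimpleGraph V} {S T : Set V} {k l : ℕ} (hS : G.CliqueBound S k)
    (hT : G.CliqueBound T l) : G.CliqueBound (S ∪ T) (k + l) := by
  classical
  intro t ht hc
  rw [← Finset.card_filter_add_card_filter_not (s := t) (· ∈ S)]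
  refine add_le_add (hS _ ?_ (hc.subset (Finset.filter_subset _ _)))
    (hT _ ?_ (hc.subset (Finset.filter_subset _ _)))
  · intro x hx
    simp at hx
    exact hx.2
  · intro x hx
    simp at hx
    exact (ht hx.1).resolve_left hx.2

theorem PerfectOn.mono {G : SimpleGraph V} {S T : Set V} (h : G.PerfectOn S) (hT : T ⊆ S) :
    G.PerfectOn T :=
  fun U hU => h U (hU.trans hT)

theorem IsIndepSet.card_inter_isClique_le {G : SimpleGraph V} [DecidableEq V] {F t : Finset V}
    (hF : G.IsIndepSet F) (ht : G.IsClique t) : (t ∩ F).card ≤ 1 := by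
  rw [Finset.card_le_one]
  intro a ha b hb
  rw [Finset.mem_inter] at ha hb
  by_contra hne
  exact hF ha.2 hb.2 hne (ht ha.1 hb.1 hne)

-- Double counting of the incidences between the vertices of `t` and the members of `m`.
open Classical in
theorem sum_countP_mem (m : Multiset (Finset V)) (t : Finset V) :
    ∑ v ∈ t, m.countP (v ∈ ·) = (m.map fun F => (t ∩ F).card).sum := by
  induction m using Multiset.induction_on with
  | empty => simp
  | cons F m ih =>
    simp only [Multiset.countP_cons, Finset.sum_add_distrib, ih, Multiset.map_cons,
      Multiset.sum_cons]
    rw [add_comm, ← Finset.filter_mem_eq_inter, Finset.card_filter]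

/-- A clique meets every stable set at most once. -/
theorem IsStableCover.sum_le {G : SimpleGraph V} {w : V → ℕ} {m : Multiset (Finset V)}
    (h : G.IsStableCover w m) {t : Finset V} (ht : G.IsClique t) : ∑ v ∈ t, w v ≤ m.card := by
  classical
  refine (Finset.sum_le_sum fun v _ => h.2 v).trans ?_
  rw [sum_countP_mem]
  refine (Multiset.sum_le_card_nsmul _ 1 ?_).trans (by simp)
  intro x hx
  obtain ⟨F, hF, rfl⟩ := Multiset.mem_map.1 hx
  exact (h.1 F hF).card_inter_isClique_le ht

theorem IsStableCover.cliqueBound {G : SimpleGraph V} {S : Set V} {m : Multiset (Finset V)}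
    (h : G.IsStableCover (setWeight S) m) : G.CliqueBound S m.card := by
  intro t ht hc
  refine le_trans ?_ (h.sum_le hc)
  rw [Finset.card_eq_sum_ones]
  exact Finset.sum_le_sum fun v hv => by simp [setWeight, ht hv]

theorem IsStableCover.mono {G : SimpleGraph V} {w w' : V → ℕ} {m : Multiset (Finset V)}
    (h : G.IsStableCover w m) (hw : ∀ v, w' v ≤ w v) : G.IsStableCover w' m :=
  ⟨h.1, fun v => (hw v).trans (h.2 v)⟩

theorem IsStableCover.add {G : SimpleGraph V} {w w' : V → ℕ} {m m' : Multiset (Finset V)}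
    (h : G.IsStableCover w m) (h' : G.IsStableCover w' m') : G.IsStableCover (w + w') (m + m') := by
  refine ⟨fun F hF => (Multiset.mem_add.1 hF).elim (h.1 F) (h'.1 F), fun v => ?_⟩
  rw [Multiset.countP_add]
  exact add_le_add (h.2 v) (h'.2 v)

/-- Lovász's replication lemma, in terms of weights. -/
theorem PerfectOn.exists_stableCover [Fintype V] {G : SimpleGraph V} {S : Set V}
    (hG : G.PerfectOn S) {w : V → ℕ} (hwS : ∀ v, v ∉ S → w v = 0) {k : ℕ}
    (hw : ∀ t : Finset V, G.IsClique t → ∑ v ∈ t, w v ≤ k) :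
    ∃ m, G.IsStableCover w m ∧ m.card = k := by
  classical
  induction hn : ∑ v, w v using Nat.strong_induction_on generalizing w k with
  | _ n ih =>
    by_cases hone : ∀ v, w v ≤ 1
    · have hb : G.CliqueBound {v | w v = 1} k := by
        intro t ht hc
        refine le_trans (le_of_eq ?_) (hw t hc)
        rw [Finset.card_eq_sum_ones]
        exact Finset.sum_congr rfl fun v hv => (ht hv).symm
      obtain ⟨m, hm, hmk⟩ := hG {v | w v = 1} (fun v hv => by
        by_contra hvS
        have := hwS v hvS
        simp only [Set.mem_ofPred_eq] at hv
        omega) k hb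
      refine ⟨m, hm.mono fun v => ?_, hmk⟩
      have := hone v
      by_cases h1 : w v = 1
      · simp [setWeight, h1]
      · omega
    · push Not at hone
      obtain ⟨v, hv⟩ := hone
      have hvS : v ∈ S := by
        by_contra hvS
        have := hwS v hvS
        omega
      -- Remove one copy of `v` and cover the rest. A class `F` through `v` then also serves as a
      -- class for the removed copy.
      set w' := Function.update w v (w v - 1) with hw'
      have hle : ∀ u, w' u ≤ w u := by
        intro u
        by_cases hu : u = v
        · subst hu; simp [hw']
        · simp [hw', hu]
      have hvw : w' v + 1 = w v := by simp [hw']; omega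
      have hsum : ∑ u, w' u < ∑ u, w u :=
        Finset.sum_lt_sum (fun u _ => hle u) ⟨v, Finset.mem_univ v, by omega⟩
      obtain ⟨m', hm', hmk'⟩ := ih _ (hn ▸ hsum) (w := w') (k := k)
        (fun u hu => by have := hle u; have := hwS u hu; omega)
        (fun t ht => (Finset.sum_le_sum fun u _ => hle u).trans (hw t ht)) rfl
      have hpos : 0 < m'.countP (v ∈ ·) := lt_of_lt_of_le (by omega) (hm'.2 v)
      obtain ⟨F, hF, hvF⟩ := Multiset.countP_pos.1 hpos
      obtain ⟨r, rfl⟩ := Multiset.exists_cons_of_mem hF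
      -- `F` will take the removed copy of `v`, so `v` itself is not decreased here. Cliques through
      -- `v` have already lost weight in `w'`; cliques avoiding `v` are bounded by the remaining `k
      -- - 1` classes `r`.
      set w'' : V → ℕ := fun u => if u ∈ F ∧ u ≠ v then w' u - 1 else w' u with hw''
      have hle'' : ∀ u, w'' u ≤ w' u := by
        intro u
        simp only [hw'']
        split_ifs <;> omega
      have hvw'' : w'' v = w' v := by simp [hw'']
      have hr : ∀ u, u ≠ v → w'' u ≤ r.countP (u ∈ ·) := by
        intro u hu
        have := hm'.2 u
        rw [Multiset.countP_cons] at this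
        simp only [hw'']
        split_ifs at this ⊢ <;> first | omega | (exfalso; tauto)
      have hbound : ∀ t : Finset V, G.IsClique t → ∑ u ∈ t, w'' u ≤ k - 1 := by
        intro t ht
        by_cases hvt : v ∈ t
        · have h1 : ∑ u ∈ t, w' u < ∑ u ∈ t, w u :=
            Finset.sum_lt_sum (fun u _ => hle u) ⟨v, hvt, by omega⟩
          have h2 : ∑ u ∈ t, w'' u ≤ ∑ u ∈ t, w' u := Finset.sum_le_sum fun u _ => hle'' u
          have := hw t ht
          omega
        · have hcov : G.IsStableCover (fun u => if u = v then 0 else w'' u) r := by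
            refine ⟨fun F' hF' => hm'.1 F' (Multiset.mem_cons_of_mem hF'), fun u => ?_⟩
            by_cases hu : u = v
            · simp [hu]
            · simpa [hu] using hr u hu
          have h1 := hcov.sum_le ht
          have h2 : ∑ u ∈ t, (if u = v then 0 else w'' u) = ∑ u ∈ t, w'' u :=
            Finset.sum_congr rfl fun u hu => if_neg fun h => hvt (by rwa [← h])
          rw [Multiset.card_cons] at hmk'
          omega
      obtain ⟨m, hm, hmk⟩ := ih (∑ u, w'' u)
        (lt_of_le_of_lt (Finset.sum_le_sum fun u _ => hle'' u) (hn ▸ hsum)) (w := w'') (k := k - 1)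
        (fun u hu => by have := hle u; have := hle'' u; have := hwS u hu; omega) hbound rfl
      refine ⟨F ::ₘ m, ⟨?_, fun u => ?_⟩, ?_⟩
      · intro F' hF'
        rcases Multiset.mem_cons.1 hF' with rfl | hF'
        · exact hm'.1 _ (Multiset.mem_cons_self _ _)
        · exact hm.1 F' hF'
      · rw [Multiset.countP_cons]
        have h1 := hm.2 u
        by_cases hu : u = v
        · subst hu
          rw [if_pos hvF]
          omega
        · have h2 : w' u = w u := by simp [hw', hu]
          simp only [hw'', h2] at h1
          split_ifs at h1 ⊢ <;> first | omega | (exfalso; tauto)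
      · rw [Multiset.card_cons] at hmk' ⊢
        omega

/-- Otherwise every clique misses some stable set of size `a + 1`. Weighting vertices by these
chosen sets gives total weight `|Ks| * (a + 1)`, yet a cover by `|Ks| - 1` stable sets of size at
most `a + 1` exists. -/
theorem exists_isClique_meets_max_indepSets [Fintype V] {G : SimpleGraph V}
    {S : Set V} (hG : G.PerfectOn S) {T : Set V} (hT : T ⊆ S) {a : ℕ}
    (ha : ∀ F : Finset V, ↑F ⊆ T → G.IsIndepSet F → F.card ≤ a + 1) :
    ∃ K : Finset V, ↑K ⊆ T ∧ G.IsClique K ∧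
      ∀ F : Finset V, ↑F ⊆ T → G.IsIndepSet F → F.card = a + 1 → ∃ x ∈ K, x ∈ F := by
  classical
  by_contra hcon
  push Not at hcon
  choose! f hfT hfI hfa hfd using hcon
  set Ks := (Finset.univ : Finset (Finset V)).filter fun K : Finset V =>
    ↑K ⊆ T ∧ G.IsClique (K : Set V) with hKs
  have hmem : ∀ K ∈ Ks, (K : Set V) ⊆ T ∧ G.IsClique (K : Set V) :=
    fun K hK => by simpa [hKs] using hK
  set w : V → ℕ := fun v => ∑ K ∈ Ks, if v ∈ f K then 1 else 0 with hw
  have hsumw : ∀ t : Finset V, ∑ v ∈ t, w v = ∑ K ∈ Ks, (t ∩ f K).card := by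
    intro t
    rw [hw, Finset.sum_comm]
    refine Finset.sum_congr rfl fun K _ => ?_
    rw [← Finset.filter_mem_eq_inter, Finset.card_filter]
  have hwT : ∀ v, v ∉ T → w v = 0 := by
    intro v hv
    refine Finset.sum_eq_zero fun K hK => if_neg fun hvK => hv ?_
    exact hfT K (hmem K hK).1 (hmem K hK).2 hvK
  have hbound : ∀ t : Finset V, G.IsClique t → ∑ v ∈ t, w v ≤ Ks.card - 1 := by
    intro t ht
    set t' := t.filter (· ∈ T) with ht'
    have htt : ∑ v ∈ t, w v = ∑ v ∈ t', w v := by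
      rw [ht', Finset.sum_filter]
      refine Finset.sum_congr rfl fun v _ => ?_
      split_ifs with h
      · rfl
      · exact hwT v h
    have ht'T : ↑t' ⊆ T := fun v hv => by
      have := Finset.mem_coe.1 hv
      rw [ht', Finset.mem_filter] at this
      exact this.2
    have ht'K : t' ∈ Ks := by
      rw [hKs, Finset.mem_filter]
      exact ⟨Finset.mem_univ _, ht'T, ht.subset (Finset.filter_subset _ _)⟩
    rw [htt, hsumw, ← Finset.add_sum_erase _ _ ht'K]
    -- The clique misses its own chosen stable set and meets every other one at most once, which
    -- saves exactly one.
    have h0 : (t' ∩ f t').card = 0 := by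
      rw [Finset.card_eq_zero, ← Finset.disjoint_iff_inter_eq_empty]
      exact Finset.disjoint_left.2 (hfd t' (hmem t' ht'K).1 (hmem t' ht'K).2)
    rw [h0, zero_add, ← Finset.card_erase_of_mem ht'K, Finset.card_eq_sum_ones]
    refine Finset.sum_le_sum fun K hK => ?_
    have hK' := hmem K (Finset.mem_of_mem_erase hK)
    exact (hfI K hK'.1 hK'.2).card_inter_isClique_le (hmem t' ht'K).2
  have hKspos : 0 < Ks.card := by
    refine Finset.card_pos.2 ⟨∅, ?_⟩
    simp [hKs]
  obtain ⟨m, hm, hmk⟩ := (hG.mono hT).exists_stableCover hwT hbound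
  set Tf : Finset V := Finset.univ.filter (· ∈ T)
  have h1 : ∑ v ∈ Tf, w v = Ks.card * (a + 1) := by
    rw [hsumw, Finset.sum_const_nat]
    intro K hK
    obtain ⟨hKT, hKc⟩ := hmem K hK
    rw [← hfa K hKT hKc]
    congr 1
    refine Finset.inter_eq_right.2 fun v hv => ?_
    simpa [Tf] using hfT K hKT hKc hv
  have h2 : ∑ v ∈ Tf, w v ≤ (Ks.card - 1) * (a + 1) := by
    refine (Finset.sum_le_sum fun v _ => hm.2 v).trans ?_
    rw [sum_countP_mem, ← hmk]
    refine (Multiset.sum_le_card_nsmul _ (a + 1) ?_).trans (by simp)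
    intro x hx
    obtain ⟨F, hF, rfl⟩ := Multiset.mem_map.1 hx
    refine ha _ (fun v hv => ?_) ((hm.1 F hF).mono (by simp))
    have := Finset.mem_coe.1 hv
    rw [Finset.mem_inter] at this
    simpa [Tf] using this.1
  have h3 : (Ks.card - 1) * (a + 1) < Ks.card * (a + 1) :=
    Nat.mul_lt_mul_of_pos_right (by omega) (by omega)
  omega

/-- Lovász's perfect graph theorem. -/
theorem PerfectOn.compl [Fintype V] {G : SimpleGraph V} {S : Set V} (hG : G.PerfectOn S) :
    Gᶜ.PerfectOn S := by
  classical
  intro T hT k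
  induction k generalizing T with
  | zero =>
    intro hb
    refine ⟨0, ⟨by simp, fun v => ?_⟩, rfl⟩
    have : v ∉ T := fun hv => by
      have := hb {v} (by simpa using hv) (by simp)
      simp at this
    simp [setWeight, this]
  | succ a ih =>
    intro hb
    -- `K` is a colour class of the complement; deleting it lowers the clique bound of the
    -- complement by one.
    obtain ⟨K, hKT, hKc, hK⟩ := exists_isClique_meets_max_indepSets hG hT
      (a := a) (fun F hF hFi => hb F hF ((isClique_compl G).2 hFi))
    obtain ⟨m, hm, hmk⟩ := ih (T := T \ K) (Set.sdiff_subset.trans hT) (by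
      intro F hF hFc
      have hFi : G.IsIndepSet F := (isClique_compl G).1 hFc
      have h1 := hb F (hF.trans Set.sdiff_subset) hFc
      by_contra hlt
      obtain ⟨x, hxK, hx⟩ := hK F (hF.trans Set.sdiff_subset) hFi (by omega)
      exact (hF hx).2 hxK)
    refine ⟨K ::ₘ m, ⟨?_, fun u => ?_⟩, by simp [hmk]⟩
    · intro F hF
      rcases Multiset.mem_cons.1 hF with rfl | hF
      · exact (isIndepSet_compl G).2 hKc
      · exact hm.1 F hF
    · have := hm.2 u
      rw [Multiset.countP_cons]
      by_cases huK : u ∈ K <;> by_cases huT : u ∈ T <;> simp_all [setWeight]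

theorem exists_stableCover_of_colorable [Fintype V] {G : SimpleGraph V} {S : Set V} {k : ℕ}
    (h : (G.induce S).Colorable k) : ∃ m, G.IsStableCover (setWeight S) m ∧ m.card = k := by
  classical
  obtain ⟨c⟩ := h
  refine ⟨Finset.univ.val.map fun i : Fin k => Finset.univ.filter fun v => ∃ h : v ∈ S,
    c ⟨v, h⟩ = i, ⟨?_, fun v => ?_⟩, by simp⟩
  · intro F hF
    obtain ⟨i, -, rfl⟩ := Multiset.mem_map.1 hF
    intro u hu v hv huv hadj
    simp only [Finset.coe_filter, Finset.mem_univ, true_and, Set.mem_ofPred_eq] at hu hv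
    obtain ⟨hu, hui⟩ := hu
    obtain ⟨hv, hvi⟩ := hv
    exact c.valid (v := ⟨u, hu⟩) (w := ⟨v, hv⟩) hadj (hui.trans hvi.symm)
  · by_cases hv : v ∈ S
    · simp only [setWeight, if_pos hv]
      refine Multiset.countP_pos.2 ⟨_, Multiset.mem_map.2 ⟨c ⟨v, hv⟩, Finset.mem_univ_val _, rfl⟩, ?_⟩
      simp [hv]
    · simp [setWeight, hv]

theorem IsStableCover.colorable {G : SimpleGraph V} {S : Set V} {m : Multiset (Finset V)}
    (h : G.IsStableCover (setWeight S) m) : (G.induce S).Colorable m.card := by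
  classical
  obtain ⟨l, rfl⟩ := Quot.exists_rep m
  have hex : ∀ v : S, ∃ i : Fin l.length, v.1 ∈ l[i] := by
    intro v
    have h1 := h.2 v
    simp only [setWeight, if_pos v.2] at h1
    obtain ⟨F, hF, hvF⟩ := Multiset.countP_pos.1 h1
    obtain ⟨i, hi, rfl⟩ := List.getElem_of_mem hF
    exact ⟨⟨i, hi⟩, hvF⟩
  choose c hc using hex
  refine ⟨Coloring.mk c fun {u v} huv heq => ?_⟩
  have h1 := hc u
  rw [heq] at h1
  have hF : G.IsIndepSet (l[c v] : Finset V) := h.1 _ (List.getElem_mem _)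
  exact hF h1 (hc v) (G.ne_of_adj huv) huv

theorem isPerfectGraph_iff [Fintype V] {G : SimpleGraph V} :
    G.IsPerfectGraph ↔ G.PerfectOn Set.univ := by
  classical
  constructor
  · intro h T _ k hk
    refine exists_stableCover_of_colorable ?_
    have h1 : (G.induce T).cliqueNum ≤ k := by
      obtain ⟨s, hs⟩ := (G.induce T).exists_isNClique_cliqueNum
      rw [← hs.card_eq, ← Finset.card_map (Function.Embedding.subtype _)]
      refine hk _ (fun v hv => ?_) ?_
      · simp at hv
        exact hv.1
      · intro u hu v hv huv
        simp only [Finset.coe_map, Set.mem_image, Finset.mem_coe,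
          Function.Embedding.subtype_apply] at hu hv
        obtain ⟨u, hu, rfl⟩ := hu
        obtain ⟨v, hv, rfl⟩ := hv
        exact hs.isClique hu hv (fun h => huv (h ▸ rfl))
    rw [← chromaticNumber_le_iff_colorable, h T]
    exact_mod_cast h1
  · intro h S
    refine le_antisymm ?_ cliqueNum_le_chromaticNumber
    rw [chromaticNumber_le_iff_colorable]
    obtain ⟨m, hm, hmk⟩ := h S (Set.subset_univ S) (G.induce S).cliqueNum (by
      intro t ht hc
      have := IsClique.card_le_cliqueNum (G := G.induce S)
        (t := t.attach.map ⟨fun v => ⟨v.1, ht v.2⟩, fun a b hab => by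
          exact Subtype.ext (congrArg (fun x : S => x.1) hab)⟩) (tc := by
          intro u hu v hv huv
          simp only [Finset.coe_map, Set.mem_image] at hu hv
          obtain ⟨u, -, rfl⟩ := hu
          obtain ⟨v, -, rfl⟩ := hv
          exact hc u.2 v.2 fun h => huv (Subtype.ext h))
      simpa using this)
    exact hmk ▸ hm.colorable

end Covers

/-! ### Parity of the adjacencies between an odd path and an odd antipath. -/

/-- If `f` has the right parity on every gap between consecutive elements of `J`, then it has the
right parity between any two elements of `J`. -/
theorem sum_mod_two_of_gaps (J : ℕ → Prop) (f : ℕ → ℕ) (s t : ℕ) (hst : s ≤ t) (hs : J s)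
    (ht : J t)
    (h : ∀ a b, s ≤ a → a < b → b ≤ t → J a → J b → (∀ i, a < i → i < b → ¬ J i) →
      (∑ i ∈ Finset.Ico a b, f i) % 2 = (b - a) % 2) :
    (∑ i ∈ Finset.Ico s t, f i) % 2 = (t - s) % 2 := by
  induction hn : t - s using Nat.strong_induction_on generalizing s t with
  | _ n ih =>
    rcases eq_or_lt_of_le hst with rfl | hlt
    · simp at hn; simp [← hn]
    by_cases hJ : ∃ i, s < i ∧ i < t ∧ J i
    · obtain ⟨i, hi, hi', hJi⟩ := hJ
      have h1 := ih (i - s) (by omega) s i hi.le hs hJi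
        (fun a b ha hab hb => h a b ha hab (by omega)) rfl
      have h2 := ih (t - i) (by omega) i t hi'.le hJi ht
        (fun a b ha hab hb => h a b (by omega) hab hb) rfl
      have h3 := Finset.sum_Ico_consecutive f hi.le hi'.le
      omega
    · push Not at hJ
      rw [h s t le_rfl hlt le_rfl hs ht hJ, hn]

/-- Conditions on the adjacency matrix `m` between an induced path with vertices `0, …, L` and an
antipath with vertices `0, …, M`. They hold in a Berge graph if the ends of the path are complete to
the interior of the antipath, the ends of the antipath are anticomplete to the interior of the path,
and the two interiors form neither a path pair nor an antipath pair. -/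
structure IsPathAntipathMatrix (m : ℕ → ℕ → Prop) (L M : ℕ) : Prop where
  left : ∀ j, 0 < j → j < M → m 0 j
  right : ∀ j, 0 < j → j < M → m L j
  bot : ∀ i, 0 < i → i < L → ¬ m i 0
  top : ∀ i, 0 < i → i < L → ¬ m i M
  hole : ∀ j s t, 0 < j → j < M → s + 2 ≤ t → t ≤ L → m s j → m t j →
    (∀ i, s < i → i < t → ¬ m i j) → Even (t - s)
  antihole : ∀ i c d, 0 < i → i < L → c + 2 ≤ d → d ≤ M → ¬ m i c → ¬ m i d →
    (∀ j, c < j → j < d → m i j) → Even (d - c)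
  leap : ∀ j s t, 0 < j → j + 1 < M → 0 < s → s < t → t < L →
    (∀ i, s ≤ i → i ≤ t → (m i j ↔ i = s) ∧ (m i (j + 1) ↔ i = t)) → Even (t - s)
  leap' : ∀ j s t, 0 < j → j + 1 < M → 0 < s → s < t → t < L →
    (∀ i, s ≤ i → i ≤ t → (m i (j + 1) ↔ i = s) ∧ (m i j ↔ i = t)) → Even (t - s)
  far : ∀ a b c d, 0 < a → a < L → 0 < b → b < L → (a + 2 ≤ b ∨ b + 2 ≤ a) →
    0 < c → c < d → d < M →
    (∀ j, c ≤ j → j ≤ d → (m a j ↔ j ≠ c) ∧ (m b j ↔ j ≠ d)) → Odd (d - c)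
  near : ∀ a b c d, 0 < a → a < L → 0 < b → b < L → (a + 1 = b ∨ b + 1 = a) →
    0 < c → c < d → d < M →
    (∀ j, c ≤ j → j ≤ d → (m a j ↔ j ≠ c) ∧ (m b j ↔ j ≠ d)) → Even (d - c)
  short : ∀ s c d, s + 3 ≤ L → 0 < c → c < d → d < M →
    (∀ j, c ≤ j → j ≤ d → m s j ∧ m (s + 3) j ∧ (m (s + 1) j ↔ j ≠ c) ∧ (m (s + 2) j ↔ j ≠ d)) →
    Odd (d - c)
  short' : ∀ s c d, s + 3 ≤ L → 0 < c → c < d → d < M →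
    (∀ j, c ≤ j → j ≤ d → m s j ∧ m (s + 3) j ∧ (m (s + 2) j ↔ j ≠ c) ∧ (m (s + 1) j ↔ j ≠ d)) →
    Odd (d - c)

/-- Vertex `i` of the path is complete to the interval `[c, c + e)` of the antipath. -/
def CompleteToInterval (m : ℕ → ℕ → Prop) (c e i : ℕ) : Prop :=
  ∀ j, c ≤ j → j < c + e → m i j

open Classical in
/-- Indicator of the edges of the path that are complete to the interval `[c, c + e)`. -/
noncomputable def edgeIndicator (m : ℕ → ℕ → Prop) (c e i : ℕ) : ℕ :=
  if CompleteToInterval m c e i ∧ CompleteToInterval m c e (i + 1) then 1 else 0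

/-- Any two consecutive vertices of the path that are complete to the interval are either adjacent
or at even distance. -/
def NoOddGap (m : ℕ → ℕ → Prop) (L c e : ℕ) : Prop :=
  ∀ s t, s < t → t ≤ L → CompleteToInterval m c e s → CompleteToInterval m c e t →
    (∀ i, s < i → i < t → ¬ CompleteToInterval m c e i) → Odd (t - s) → t = s + 1

theorem sum_eq_zero_of_gap {J : ℕ → Prop} {f : ℕ → ℕ} (hf : ∀ i, f i ≠ 0 → J i ∧ J (i + 1))
    {a b : ℕ} (hab : a + 2 ≤ b) (h : ∀ i, a < i → i < b → ¬ J i) :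
    ∑ i ∈ Finset.Ico a b, f i = 0 := by
  refine Finset.sum_eq_zero fun i hi => ?_
  rw [Finset.mem_Ico] at hi
  by_contra hne
  obtain ⟨h1, h2⟩ := hf i hne
  by_cases hia : i = a
  · exact h (i + 1) (by omega) (by omega) h2
  · exact h i (by omega) (by omega) h1

theorem edgeIndicator_ne_zero {m : ℕ → ℕ → Prop} {c e i : ℕ} (h : edgeIndicator m c e i ≠ 0) :
    CompleteToInterval m c e i ∧ CompleteToInterval m c e (i + 1) := by
  by_contra hn
  exact h (if_neg hn)

/-- A gap of length one contributes one complete edge, and every other gap is even and contributes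
none. -/
theorem NoOddGap.sum_mod_two {m : ℕ → ℕ → Prop} {L c e : ℕ} (h : NoOddGap m L c e) {s t : ℕ}
    (hst : s ≤ t) (ht : t ≤ L) (hs' : CompleteToInterval m c e s)
    (ht' : CompleteToInterval m c e t) :
    (∑ i ∈ Finset.Ico s t, edgeIndicator m c e i) % 2 = (t - s) % 2 := by
  refine sum_mod_two_of_gaps (CompleteToInterval m c e) _ s t hst hs' ht' ?_
  intro a b _ hab hb ha' hb' hgap
  by_cases h1 : b = a + 1
  · subst h1
    simp only [Nat.Ico_succ_singleton, Finset.sum_singleton, edgeIndicator,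
      if_pos (And.intro ha' hb')]
    simp
  · rw [sum_eq_zero_of_gap (J := CompleteToInterval m c e) (fun i hi => edgeIndicator_ne_zero hi)
      (by omega) hgap]
    have : ¬ Odd (b - a) := fun ho => h1 (h a b hab (by omega) ha' hb' hgap ho)
    rw [Nat.odd_iff] at this
    omega

theorem NoOddGap.exists_edge {m : ℕ → ℕ → Prop} {L c e : ℕ} (h : NoOddGap m L c e) {s t : ℕ}
    (hst : s ≤ t) (ht : t ≤ L) (hs' : CompleteToInterval m c e s)
    (ht' : CompleteToInterval m c e t) (hodd : Odd (t - s)) :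
    ∃ i, s ≤ i ∧ i < t ∧ CompleteToInterval m c e i ∧ CompleteToInterval m c e (i + 1) := by
  have h1 := h.sum_mod_two hst ht hs' ht'
  rw [Nat.odd_iff] at hodd
  have h2 : ∑ i ∈ Finset.Ico s t, edgeIndicator m c e i ≠ 0 := by omega
  obtain ⟨i, hi, hne⟩ := Finset.exists_ne_zero_of_sum_ne_zero h2
  rw [Finset.mem_Ico] at hi
  exact ⟨i, hi.1, hi.2, edgeIndicator_ne_zero hne⟩

namespace IsPathAntipathMatrix

variable {m : ℕ → ℕ → Prop} {L M : ℕ}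

/-- Inside a bad gap, each of the two subintervals of length `e` has a complete edge of the path.
Interior vertices complete to different subintervals must be adjacent, by `far`; this leaves only a
gap of length three, excluded by `short` and `short'`. -/
theorem noOddGap_odd (h : IsPathAntipathMatrix m L M) {c e : ℕ} (hc : 0 < c) (heM : c + e < M)
    (he : Even e) (he' : 2 ≤ e) (h1 : NoOddGap m L (c + 1) e) (h2 : NoOddGap m L c e) :
    NoOddGap m L c (e + 1) := by
  intro s t hst ht hs' ht' hgap hodd
  by_contra hne
  have hodd' := hodd
  have hev := Nat.even_iff.1 he
  rw [Nat.odd_iff] at hodd'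
  obtain ⟨i, hi, hit, hi1, hi2⟩ := h1.exists_edge hst.le ht
    (fun j hj hj' => hs' j (by omega) (by omega)) (fun j hj hj' => ht' j (by omega) (by omega)) hodd
  obtain ⟨k, hk, hkt, hk1, hk2⟩ := h2.exists_edge hst.le ht
    (fun j hj hj' => hs' j (by omega) (by omega)) (fun j hj hj' => ht' j (by omega) (by omega)) hodd
  have key : ∀ a b, s < a → a < t → s < b → b < t → CompleteToInterval m (c + 1) e a →
      CompleteToInterval m c e b →
      ∀ j, c ≤ j → j ≤ c + e → (m a j ↔ j ≠ c) ∧ (m b j ↔ j ≠ c + e) := by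
    intro a b ha ha' hb hb' hac hbc j hj hj'
    constructor
    · refine ⟨?_, fun hjc => hac j (by omega) (by omega)⟩
      rintro hm rfl
      refine hgap a ha ha' fun j' h3 h4 => ?_
      by_cases h5 : j' = j
      · exact h5 ▸ hm
      · exact hac j' (by omega) (by omega)
    · refine ⟨?_, fun hjc => hbc j (by omega) (by omega)⟩
      rintro hm rfl
      refine hgap b hb hb' fun j' h3 h4 => ?_
      by_cases h5 : j' = c + e
      · exact h5 ▸ hm
      · exact hbc j' (by omega) (by omega)
  have adj : ∀ a b, s < a → a < t → s < b → b < t → CompleteToInterval m (c + 1) e a →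
      CompleteToInterval m c e b → a + 1 = b ∨ b + 1 = a := by
    intro a b ha ha' hb hb' hac hbc
    have hk := key a b ha ha' hb hb' hac hbc
    by_contra hnadj
    by_cases hab : a = b
    · subst hab
      have := (hk c le_rfl (by omega)).1
      have := (hk c le_rfl (by omega)).2
      have : c ≠ c + e := by omega
      tauto
    · have := h.far a b c (c + e) (by omega) (by omega) (by omega) (by omega) (by omega) hc
        (by omega) (by omega) hk
      rw [Nat.odd_iff] at this
      omega
  -- No vertex is adjacent to, but distinct from, both ends of an edge of the path. So neither edge
  -- avoids both ends of the gap, and the two edges are the first and the last of a gap of length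
  -- three.
  have e11 : s < i → s < k → _ := fun p q => adj i k p (by omega) q (by omega) hi1 hk1
  have e12 : s < i → k + 1 < t → _ := fun p q => adj i (k + 1) p (by omega) (by omega) q hi1 hk2
  have e21 : i + 1 < t → s < k → _ := fun p q => adj (i + 1) k (by omega) p q (by omega) hi2 hk1
  have e22 : i + 1 < t → k + 1 < t → _ :=
    fun p q => adj (i + 1) (k + 1) (by omega) p (by omega) q hi2 hk2
  have hcase : (i = s ∧ k = s + 2 ∧ t = s + 3) ∨ (k = s ∧ i = s + 2 ∧ t = s + 3) := by omega
  rcases hcase with ⟨rfl, rfl, rfl⟩ | ⟨rfl, rfl, rfl⟩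
  · have hkk := key (i + 1) (i + 2) (by omega) (by omega) (by omega) (by omega) hi2 hk1
    have := h.short i c (c + e) ht hc (by omega) (by omega) fun j hj hj' =>
      ⟨hs' j hj (by omega), ht' j hj (by omega), hkk j hj hj'⟩
    rw [Nat.odd_iff] at this
    omega
  · have hkk := key (k + 2) (k + 1) (by omega) (by omega) (by omega) (by omega) hi1 hk2
    have := h.short' k c (c + e) ht hc (by omega) (by omega) fun j hj hj' =>
      ⟨hs' j hj (by omega), ht' j hj (by omega), hkk j hj hj'⟩
    rw [Nat.odd_iff] at this
    omega

/-- Length one is excluded by `near`, and `e = 1` is the case of a leap. For larger `e`, both ends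
are complete to the common part of length `e - 1`; an odd distance would give a vertex strictly
between them complete to that part but missing both `c` and `c + e`, hence an odd antihole. -/
theorem even_of_transition (h : IsPathAntipathMatrix m L M) {c e a b : ℕ} (hc : 0 < c)
    (heM : c + e < M) (he : Odd e) (ha0 : 0 < a) (hab : a < b) (hbL : b < L)
    (h0 : 2 ≤ e → NoOddGap m L (c + 1) (e - 1))
    (hends : (∀ j, c ≤ j → j ≤ c + e → (m a j ↔ j ≠ c) ∧ (m b j ↔ j ≠ c + e)) ∨
      (∀ j, c ≤ j → j ≤ c + e → (m b j ↔ j ≠ c) ∧ (m a j ↔ j ≠ c + e)))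
    (hgap : ∀ i, a < i → i < b → ¬ CompleteToInterval m (c + 1) e i ∧
      ¬ CompleteToInterval m c e i) : Even (b - a) := by
  by_contra hodd
  rw [Nat.not_even_iff_odd] at hodd
  have hodd' := Nat.odd_iff.1 hodd
  have he' := Nat.odd_iff.1 he
  by_cases hab1 : a + 1 = b
  · have : Even (c + e - c) := by
      rcases hends with hk | hk
      · exact h.near a b c (c + e) ha0 (by omega) (by omega) hbL (by omega) hc (by omega) heM hk
      · exact h.near b a c (c + e) (by omega) hbL (by omega) (by omega) (by omega) hc (by omega)
          heM hk
    rw [Nat.even_iff] at this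
    omega
  by_cases he1 : e = 1
  · subst he1
    have hn : ∀ i, a < i → i < b → ¬ m i c ∧ ¬ m i (c + 1) := by
      intro i hi hi'
      obtain ⟨h1, h2⟩ := hgap i hi hi'
      refine ⟨fun hm => h2 fun j hj hj' => ?_, fun hm => h1 fun j hj hj' => ?_⟩
      · obtain rfl : j = c := by omega
        exact hm
      · obtain rfl : j = c + 1 := by omega
        exact hm
    have hev : Even (b - a) := by
      rcases hends with hk | hk
      · refine h.leap' c a b hc heM ha0 hab hbL fun i hi hi' => ?_
        have k1 := hk c le_rfl (by omega)
        have k2 := hk (c + 1) (by omega) le_rfl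
        rcases eq_or_lt_of_le hi with rfl | hi1
        · simp_all; omega
        rcases eq_or_lt_of_le hi' with rfl | hi2
        · simp_all; omega
        have := hn i hi1 hi2
        constructor <;> constructor <;> intro h <;> first | omega | tauto
      · refine h.leap c a b hc heM ha0 hab hbL fun i hi hi' => ?_
        have k1 := hk c le_rfl (by omega)
        have k2 := hk (c + 1) (by omega) le_rfl
        rcases eq_or_lt_of_le hi with rfl | hi1
        · simp_all; omega
        rcases eq_or_lt_of_le hi' with rfl | hi2
        · simp_all; omega
        have := hn i hi1 hi2
        constructor <;> constructor <;> intro h <;> first | omega | tauto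
    rw [Nat.even_iff] at hev
    omega
  · have hac : CompleteToInterval m (c + 1) (e - 1) a := by
      intro j hj hj'
      rcases hends with hk | hk
      · exact (hk j (by omega) (by omega)).1.2 (by omega)
      · exact (hk j (by omega) (by omega)).2.2 (by omega)
    have hbc : CompleteToInterval m (c + 1) (e - 1) b := by
      intro j hj hj'
      rcases hends with hk | hk
      · exact (hk j (by omega) (by omega)).2.2 (by omega)
      · exact (hk j (by omega) (by omega)).1.2 (by omega)
    obtain ⟨i, hi, hib, hi1, hi2⟩ := (h0 (by omega)).exists_edge hab.le hbL.le hac hbc hodd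
    obtain ⟨g, hg, hgb, hgc⟩ : ∃ g, a < g ∧ g < b ∧ CompleteToInterval m (c + 1) (e - 1) g := by
      by_cases hia : i = a
      · exact ⟨i + 1, by omega, by omega, hi2⟩
      · exact ⟨i, by omega, by omega, hi1⟩
    obtain ⟨h1, h2⟩ := hgap g hg hgb
    have := h.antihole g c (c + e) (by omega) (by omega) (by omega) heM.le
      (fun hm => h2 fun j hj hj' => by
        by_cases hjc : j = c
        · exact hjc ▸ hm
        · exact hgc j (by omega) (by omega))
      (fun hm => h1 fun j hj hj' => by
        by_cases hjc : j = c + e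
        · exact hjc ▸ hm
        · exact hgc j (by omega) (by omega))
      (fun j hj hj' => hgc j (by omega) (by omega))
    rw [Nat.even_iff] at this
    omega

/-- Count the edges complete to either subinterval of length `e`, inside a bad gap. Adding the two
separate counts gives an even total; running through the vertices complete to at least one
subinterval gives an odd one. -/
theorem noOddGap_even (h : IsPathAntipathMatrix m L M) {c e : ℕ} (hc : 0 < c) (heM : c + e < M)
    (he : Odd e) (h0 : 2 ≤ e → NoOddGap m L (c + 1) (e - 1))
    (h1 : NoOddGap m L (c + 1) e) (h2 : NoOddGap m L c e) :
    NoOddGap m L c (e + 1) := by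
  intro s t hst ht hs' ht' hgap hodd
  by_contra hne
  have he' := Nat.odd_iff.1 he
  have hodd' := Nat.odd_iff.1 hodd
  -- The union of the two subintervals is the whole interval, so no interior vertex of the gap is
  -- complete to both and no edge is counted twice.
  have both : ∀ i, CompleteToInterval m (c + 1) e i → CompleteToInterval m c e i →
      CompleteToInterval m c (e + 1) i := by
    intro i hi1 hi2 j hj hj'
    by_cases hjc : j = c
    · exact hi2 j hj (by omega)
    · exact hi1 j (by omega) (by omega)
  have hs1 : CompleteToInterval m (c + 1) e s := fun j hj hj' => hs' j (by omega) (by omega)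
  have hs2 : CompleteToInterval m c e s := fun j hj hj' => hs' j (by omega) (by omega)
  have ht1 : CompleteToInterval m (c + 1) e t := fun j hj hj' => ht' j (by omega) (by omega)
  have ht2 : CompleteToInterval m c e t := fun j hj hj' => ht' j (by omega) (by omega)
  have trans : ∀ a b, s ≤ a → a < b → b ≤ t →
      (CompleteToInterval m (c + 1) e a ∨ CompleteToInterval m c e a) →
      (CompleteToInterval m (c + 1) e b ∨ CompleteToInterval m c e b) →
      ¬ (CompleteToInterval m (c + 1) e a ∧ CompleteToInterval m (c + 1) e b) →
      ¬ (CompleteToInterval m c e a ∧ CompleteToInterval m c e b) →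
      (∀ i, a < i → i < b → ¬ (CompleteToInterval m (c + 1) e i ∨ CompleteToInterval m c e i)) →
      Even (b - a) := by
    intro a b hsa hab hbt hJa hJb hn1 hn2 hg
    have hor : CompleteToInterval m (c + 1) e a ∧ CompleteToInterval m c e b ∨
        CompleteToInterval m c e a ∧ CompleteToInterval m (c + 1) e b := by
      rcases hJa with p | p <;> rcases hJb with q | q
      · exact absurd ⟨p, q⟩ hn1
      · exact Or.inl ⟨p, q⟩
      · exact Or.inr ⟨p, q⟩
      · exact absurd ⟨p, q⟩ hn2
    have has : s ≠ a := by
      rintro rfl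
      rcases hor with ⟨_, q⟩ | ⟨_, q⟩
      · exact hn2 ⟨hs2, q⟩
      · exact hn1 ⟨hs1, q⟩
    have hbt' : b ≠ t := by
      rintro rfl
      rcases hor with ⟨p, _⟩ | ⟨p, _⟩
      · exact hn1 ⟨p, ht1⟩
      · exact hn2 ⟨p, ht2⟩
    have form : ∀ a b, s < a → a < t → s < b → b < t →
        CompleteToInterval m (c + 1) e a → CompleteToInterval m c e b →
        ∀ j, c ≤ j → j ≤ c + e → (m a j ↔ j ≠ c) ∧ (m b j ↔ j ≠ c + e) := by
      intro a b ha ha' hb hb' hac hbc j hj hj'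
      constructor
      · refine ⟨?_, fun hjc => hac j (by omega) (by omega)⟩
        rintro hm rfl
        refine hgap a ha ha' fun j' h3 h4 => ?_
        by_cases h5 : j' = j
        · exact h5 ▸ hm
        · exact hac j' (by omega) (by omega)
      · refine ⟨?_, fun hjc => hbc j (by omega) (by omega)⟩
        rintro hm rfl
        refine hgap b hb hb' fun j' h3 h4 => ?_
        by_cases h5 : j' = c + e
        · exact h5 ▸ hm
        · exact hbc j' (by omega) (by omega)
    have hends : (∀ j, c ≤ j → j ≤ c + e → (m a j ↔ j ≠ c) ∧ (m b j ↔ j ≠ c + e)) ∨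
      (∀ j, c ≤ j → j ≤ c + e → (m b j ↔ j ≠ c) ∧ (m a j ↔ j ≠ c + e)) := by
      rcases hor with ⟨p, q⟩ | ⟨p, q⟩
      · exact Or.inl (form a b (by omega) (by omega) (by omega) (by omega) p q)
      · exact Or.inr (form b a (by omega) (by omega) (by omega) (by omega) q p)
    exact h.even_of_transition hc heM he (by omega) hab (by omega) h0 hends
      (fun i hi hi' => not_or.1 (hg i hi hi'))
  have S1 := h1.sum_mod_two hst.le ht hs1 ht1
  have S2 := h2.sum_mod_two hst.le ht hs2 ht2
  -- A gap whose ends are complete to the same subinterval is handled by `h1` or `h2`; one that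
  -- switches subintervals is even by `trans`, so it is never a single edge.
  have S3 := sum_mod_two_of_gaps
    (fun i => CompleteToInterval m (c + 1) e i ∨ CompleteToInterval m c e i)
    (fun i => edgeIndicator m (c + 1) e i + edgeIndicator m c e i) s t hst.le (Or.inl hs1)
    (Or.inl ht1) (by
      intro a b hsa hab hbt hJa hJb hg
      have htr := trans a b hsa hab hbt
      by_cases hb1 : b = a + 1
      · subst hb1
        have hnb : ¬ ((CompleteToInterval m (c + 1) e a ∧ CompleteToInterval m (c + 1) e (a + 1)) ∧
            (CompleteToInterval m c e a ∧ CompleteToInterval m c e (a + 1))) := by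
          rintro ⟨⟨p, q⟩, p', q'⟩
          by_cases hsa' : s = a
          · exact hgap (a + 1) (by omega) (by omega) (both _ q q')
          · exact hgap a (by omega) (by omega) (both _ p p')
        have hodd1 : ¬ Even (a + 1 - a) := by simp
        have hsome : (CompleteToInterval m (c + 1) e a ∧ CompleteToInterval m (c + 1) e (a + 1)) ∨
            (CompleteToInterval m c e a ∧ CompleteToInterval m c e (a + 1)) := by
          by_contra hno
          rw [not_or] at hno
          exact hodd1 (htr hJa hJb hno.1 hno.2 hg)
        simp only [Nat.Ico_succ_singleton, Finset.sum_singleton, edgeIndicator]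
        rcases hsome with h | h
        · rw [if_pos h, if_neg (fun h' => hnb ⟨h, h'⟩)]; simp
        · rw [if_pos h, if_neg (fun h' => hnb ⟨h', h⟩)]; simp
      · rw [sum_eq_zero_of_gap (J := fun i => CompleteToInterval m (c + 1) e i ∨
          CompleteToInterval m c e i) ?_ (by omega) hg]
        · have : Even (b - a) := by
            by_contra ho
            rw [Nat.not_even_iff_odd] at ho
            by_cases c1 : CompleteToInterval m (c + 1) e a ∧ CompleteToInterval m (c + 1) e b
            · exact hb1 (h1 a b hab (by omega) c1.1 c1.2
                (fun i hi hi' hh => hg i hi hi' (Or.inl hh)) ho)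
            by_cases c2 : CompleteToInterval m c e a ∧ CompleteToInterval m c e b
            · exact hb1 (h2 a b hab (by omega) c2.1 c2.2
                (fun i hi hi' hh => hg i hi hi' (Or.inr hh)) ho)
            exact (Nat.not_even_iff_odd.2 ho) (htr hJa hJb c1 c2 hg)
          rw [Nat.even_iff] at this
          omega
        · intro i hi
          by_cases h0 : edgeIndicator m (c + 1) e i = 0
          · have := edgeIndicator_ne_zero (m := m) (c := c) (e := e) (i := i) (by omega)
            exact ⟨Or.inr this.1, Or.inr this.2⟩
          · have := edgeIndicator_ne_zero h0
            exact ⟨Or.inl this.1, Or.inl this.2⟩)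
  rw [Finset.sum_add_distrib] at S3
  omega

/-- Induction on the interval length: for length 0 every vertex is complete, for length 1 this is
the absence of odd holes, and then the two parities alternate. -/
theorem noOddGap (h : IsPathAntipathMatrix m L M) (e : ℕ) :
    ∀ c, 0 < c → c + e ≤ M → NoOddGap m L c e := by
  induction e using Nat.strong_induction_on with
  | _ e ih =>
    intro c hc heM
    match e, ih with
    | 0, _ =>
      intro s t hst _ _ _ hgap _
      by_contra hne
      exact hgap (s + 1) (by omega) (by omega) (fun j hj hj' => by omega)
    | 1, _ =>
      intro s t hst ht hs' ht' hgap hodd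
      by_contra hne
      have := h.hole c s t hc (by omega) (by omega) ht (hs' c le_rfl (by omega))
        (ht' c le_rfl (by omega)) fun i hi hi' hm => hgap i hi hi' fun j hj hj' => by
          obtain rfl : j = c := by omega
          exact hm
      exact (Nat.not_even_iff_odd.2 hodd) this
    | e + 2, ih =>
      have h1 := ih (e + 1) (by omega) (c + 1) (by omega) (by omega)
      have h2 := ih (e + 1) (by omega) c hc (by omega)
      rcases Nat.even_or_odd (e + 1) with he | he
      · have := Nat.even_iff.1 he
        exact h.noOddGap_odd hc (by omega) he (by omega) h1 h2
      · exact h.noOddGap_even hc (by omega) he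
          (fun _ => ih e (by omega) (c + 1) (by omega) (by omega)) h1 h2

/-- The ends of the path are complete to the interior of the antipath, so by parity some edge is.
Its end inside the path misses both ends of the antipath and closes an antihole of odd length `M +
2`. -/
theorem not_odd (h : IsPathAntipathMatrix m L M) (hL : Odd L) (hL3 : 3 ≤ L) (hM : Odd M)
    (hM3 : 3 ≤ M) : False := by
  obtain ⟨i, hi, hiL, hi1, hi2⟩ := (h.noOddGap (M - 1) 1 one_pos (by omega)).exists_edge
    (Nat.zero_le L) le_rfl (fun j hj hj' => h.left j hj (by omega))
    (fun j hj hj' => h.right j hj (by omega)) (by simpa using hL)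
  obtain ⟨g, hg, hgL, hgc⟩ : ∃ g, 0 < g ∧ g < L ∧ CompleteToInterval m 1 (M - 1) g := by
    by_cases hi0 : i = 0
    · exact ⟨i + 1, by omega, by omega, hi2⟩
    · exact ⟨i, by omega, hiL, hi1⟩
  have := h.antihole g 0 M hg hgL (by omega) le_rfl (h.bot g hg hgL) (h.top g hg hgL)
    fun j hj hj' => hgc j (by omega) (by omega)
  rw [Nat.sub_zero] at this
  exact (Nat.not_even_iff_odd.2 hM) this

end IsPathAntipathMatrix

/-! ### Induced paths and cycles as sequences indexed by `ℕ`. -/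

section Sequences

variable {V : Type*}

/-- The vertices `f 0, …, f n` form, in this order, an induced path. -/
def IsPathSeq (G : SimpleGraph V) (f : ℕ → V) (n : ℕ) : Prop :=
  ∀ i j, i < j → j ≤ n → (G.Adj (f i) (f j) ↔ j = i + 1)

/-- The vertices `f 0, …, f (n - 1)` form, in this order, an induced cycle. -/
def IsCycleSeq (G : SimpleGraph V) (f : ℕ → V) (n : ℕ) : Prop :=
  ∀ i j, i < j → j < n → (G.Adj (f i) (f j) ↔ j = i + 1 ∨ i = 0 ∧ j + 1 = n)

/-- The adjacency pattern alone forces injectivity, as two equal vertices would be at distance two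
and a further vertex of the path tells them apart. For `n = 2` there is none, and `f 0 = f 2` is
possible. -/
theorem IsPathSeq.ne {G : SimpleGraph V} {f : ℕ → V} {n : ℕ} (h : G.IsPathSeq f n) (hn : 3 ≤ n)
    {i j : ℕ} (hij : i < j) (hj : j ≤ n) : f i ≠ f j := by
  intro heq
  by_cases h1 : j = i + 1
  · exact G.ne_of_adj ((h i j hij hj).2 h1) heq
  have h2 : G.Adj (f i) (f (i + 1)) := (h i (i + 1) (by omega) (by omega)).2 rfl
  rw [heq] at h2
  have h3 := (h (i + 1) j (by omega) hj).1 h2.symm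
  by_cases hjn : j < n
  · have h4 : G.Adj (f j) (f (j + 1)) := (h j (j + 1) (by omega) (by omega)).2 rfl
    rw [← heq] at h4
    have := (h i (j + 1) (by omega) (by omega)).1 h4
    omega
  · have h4 : G.Adj (f (i - 1)) (f i) := (h (i - 1) i (by omega) (by omega)).2 (by omega)
    rw [heq] at h4
    have := (h (i - 1) j (by omega) (by omega)).1 h4
    omega

/-- For `n = 4` opposite vertices have the same neighbours and may coincide, whence the bound five.
-/
theorem IsCycleSeq.ne {G : SimpleGraph V} {f : ℕ → V} {n : ℕ} (h : G.IsCycleSeq f n) (hn : 5 ≤ n)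
    {i j : ℕ} (hij : i < j) (hj : j < n) : f i ≠ f j := by
  intro heq
  by_cases h1 : j = i + 1
  · exact G.ne_of_adj ((h i j hij hj).2 (Or.inl h1)) heq
  have h2 : G.Adj (f i) (f (i + 1)) := (h i (i + 1) (by omega) (by omega)).2 (Or.inl rfl)
  rw [heq] at h2
  have h3 := (h (i + 1) j (by omega) hj).1 h2.symm
  by_cases hjn : j + 1 < n
  · have h4 : G.Adj (f j) (f (j + 1)) := (h j (j + 1) (by omega) (by omega)).2 (Or.inl rfl)
    rw [← heq] at h4
    have := (h i (j + 1) (by omega) (by omega)).1 h4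
    omega
  · have h4 : G.Adj (f (i - 1)) (f i) := (h (i - 1) i (by omega) (by omega)).2 (by omega)
    rw [heq] at h4
    have := (h (i - 1) j (by omega) (by omega)).1 h4
    omega

theorem HasInducedPath.exists_isPathSeq {G : SimpleGraph V} {n : ℕ} {u v : V} {X : Set V}
    (h : G.HasInducedPath n u v X) :
    ∃ f, G.IsPathSeq f n ∧ f 0 = u ∧ f n = v ∧ ∀ i, 0 < i → i < n → f i ∈ X := by
  obtain ⟨p, hu, hv, hX⟩ := h
  refine ⟨fun i => p ⟨min i n, by omega⟩, fun i j hij hj => ?_, ?_, ?_, fun i hi hin => ?_⟩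
  · rw [p.map_adj_iff, pathGraph_adj]
    simp only
    omega
  · rw [← hu]; congr 1
  · rw [← hv]; simp [Fin.last]
  · refine hX _ ?_ ?_ <;> rw [ne_eq, Fin.ext_iff] <;> simp <;> omega

theorem IsPathSeq.hasInducedPath {G : SimpleGraph V} {n : ℕ} {f : ℕ → V} {X : Set V}
    (h : G.IsPathSeq f n) (hn : 3 ≤ n) (hX : ∀ i, 0 < i → i < n → f i ∈ X) :
    G.HasInducedPath n (f 0) (f n) X := by
  have hinj : Function.Injective fun i : Fin (n + 1) => f i.1 := by
    intro i j hij
    rcases lt_trichotomy i.1 j.1 with hlt | heq | hlt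
    · exact absurd hij (h.ne hn hlt (by omega))
    · exact Fin.ext heq
    · exact absurd hij.symm (h.ne hn hlt (by omega))
  have hadj : ∀ i j : Fin (n + 1), G.Adj (f i.1) (f j.1) ↔ (pathGraph (n + 1)).Adj i j := by
    intro i j
    rw [pathGraph_adj]
    rcases lt_trichotomy i.1 j.1 with hlt | heq | hlt
    · rw [h i j hlt (by omega)]
      omega
    · have := Fin.ext heq
      subst this
      simp
    · rw [G.adj_comm, h j i hlt (by omega)]
      omega
  refine ⟨⟨⟨fun i => f i.1, hinj⟩, fun {i j} => hadj i j⟩, rfl, rfl, fun i hi hi' => hX i ?_ ?_⟩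
  · rw [ne_eq, Fin.ext_iff, Fin.val_zero] at hi
    omega
  · rw [ne_eq, Fin.ext_iff, Fin.val_last] at hi'
    omega

theorem IsCycleSeq.hasHole {G : SimpleGraph V} {n : ℕ} {f : ℕ → V}
    (h : G.IsCycleSeq f n) (hn : 5 ≤ n) : G.HasHole n := by
  have hinj : Function.Injective fun i : Fin n => f i.1 := by
    intro i j hij
    rcases lt_trichotomy i.1 j.1 with hlt | heq | hlt
    · exact absurd hij (h.ne hn hlt (by omega))
    · exact Fin.ext heq
    · exact absurd hij.symm (h.ne hn hlt (by omega))
  have hadj : ∀ i j : Fin n, G.Adj (f i.1) (f j.1) ↔ (cycleGraph n).Adj i j := by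
    intro i j
    rw [cycleGraph_adj']
    rcases lt_trichotomy i.1 j.1 with hlt | heq | hlt
    · rw [h i j hlt (by omega), Fin.coe_sub_iff_lt.2 hlt, Fin.coe_sub_iff_le.2 hlt.le]
      omega
    · have := Fin.ext heq
      subst this
      have : (i - i).val = 0 := by rw [Fin.coe_sub_iff_le.2 le_rfl]; omega
      simp [this]
    · rw [G.adj_comm, h j i hlt (by omega), Fin.coe_sub_iff_lt.2 hlt, Fin.coe_sub_iff_le.2 hlt.le]
      omega
  exact ⟨by omega, ⟨⟨⟨fun i => f i.1, hinj⟩, fun {i j} => hadj i j⟩⟩⟩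

/-- Every induced cycle of length at least five in `S`, in the graph or in its complement, is
even. -/
def BergeOn (G : SimpleGraph V) (S : Set V) : Prop :=
  ∀ f n, 5 ≤ n → (∀ i < n, f i ∈ S) → G.IsCycleSeq f n ∨ Gᶜ.IsCycleSeq f n → Even n

theorem IsBerge.bergeOn {G : SimpleGraph V} (h : G.IsBerge) (S : Set V) : G.BergeOn S := by
  intro f n hn _ hf
  rcases hf with hf | hf
  · exact (h n).1 (hf.hasHole hn)
  · exact (h n).2 (hf.hasHole hn)

theorem IsBerge.compl {G : SimpleGraph V} (h : G.IsBerge) : Gᶜ.IsBerge := by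
  intro n
  refine ⟨(h n).2, fun h' => (h n).1 ?_⟩
  rwa [HasAntihole, compl_compl] at h'

theorem IsBerge.even_cycle {G : SimpleGraph V} (h : G.IsBerge) {f : ℕ → V} {n : ℕ} (hn : 5 ≤ n)
    (hf : G.IsCycleSeq f n) : Even n :=
  (h n).1 (hf.hasHole hn)

theorem hole_seq {G : SimpleGraph V} {n : ℕ} (e : cycleGraph n ↪g G) (x : V) :
    G.IsCycleSeq (fun i => if h : i < n then e ⟨i, h⟩ else x) n := by
  intro i j hij hj
  have hi : i < n := by omega
  simp only [hi, hj, dif_pos]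
  rw [e.map_adj_iff, cycleGraph_adj',
    Fin.coe_sub_iff_lt.2 (show (⟨i, hi⟩ : Fin n) < ⟨j, hj⟩ from hij),
    Fin.coe_sub_iff_le.2 (show (⟨i, hi⟩ : Fin n) ≤ ⟨j, hj⟩ from hij.le)]
  simp only
  omega

theorem BergeOn.comap_isBerge {W : Type*} {G : SimpleGraph V} {S : Set V} (h : G.BergeOn S)
    (e : W ↪ V) (he : ∀ x, e x ∈ S) : (G.comap e).IsBerge := by
  have key : ∀ (H : SimpleGraph V) (n : ℕ), (∀ f n, 5 ≤ n → (∀ i < n, f i ∈ S) →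
      H.IsCycleSeq f n → Even n) → (H.comap e).HasHole n → Even n := by
    rintro H n hH ⟨hn, ⟨c⟩⟩
    by_contra hodd
    rw [Nat.not_even_iff_odd] at hodd
    have h5 : 5 ≤ n := by
      have := Nat.odd_iff.1 hodd
      omega
    have hs := hole_seq c (c ⟨0, by omega⟩)
    refine Nat.not_even_iff_odd.2 hodd (hH (fun i => e (if h : i < n then c ⟨i, h⟩ else
      c ⟨0, by omega⟩)) n h5 (fun i _ => he _) fun i j hij hj => ?_)
    exact hs i j hij hj
  intro n
  refine ⟨key G n fun f n h1 h2 h3 => h f n h1 h2 (Or.inl h3), fun hh => ?_⟩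
  refine key Gᶜ n (fun f n h1 h2 h3 => h f n h1 h2 (Or.inr h3)) ?_
  have heq : (G.comap e)ᶜ = Gᶜ.comap e := by
    ext x y
    simp [compl_adj]
  rwa [HasAntihole, heq] at hh

/-- A cycle can be rotated. -/
theorem IsCycleSeq.rotate {G : SimpleGraph V} {f : ℕ → V} {n : ℕ} (h : G.IsCycleSeq f n) {k : ℕ}
    (hk : k < n) : G.IsCycleSeq (fun i => if i + k < n then f (i + k) else f (i + k - n)) n := by
  intro i j hij hj
  simp only
  split_ifs with h1 h2 h2
  · rw [h _ _ (by omega) h2]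
    omega
  · rw [G.adj_comm, h _ _ (by omega) h1]
    omega
  · omega
  · rw [h _ _ (by omega) (by omega)]
    omega

end Sequences

/-! ### Consequences of minimality; star cutsets. -/

section MinimumImperfect

variable {V : Type*} {G : SimpleGraph V}

theorem PerfectOn.of_comap {W : Type*} {H : SimpleGraph V} (e : W ↪ V)
    (h : (H.comap e).PerfectOn Set.univ) : H.PerfectOn (Set.range e) := by
  classical
  intro T hT k hk
  obtain ⟨m, hm, hmk⟩ := h (e ⁻¹' T) (Set.subset_univ _) k (by
    intro t ht hc
    rw [← Finset.card_map e]
    refine hk _ (fun v hv => ?_) ?_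
    · obtain ⟨x, hx, rfl⟩ := Finset.mem_map.1 (Finset.mem_coe.1 hv)
      exact ht hx
    · intro u hu v hv huv
      obtain ⟨x, hx, rfl⟩ := Finset.mem_map.1 (Finset.mem_coe.1 hu)
      obtain ⟨y, hy, rfl⟩ := Finset.mem_map.1 (Finset.mem_coe.1 hv)
      exact hc hx hy fun h => huv (h ▸ rfl))
  refine ⟨m.map (Finset.map e), ⟨?_, fun v => ?_⟩, by simp [hmk]⟩
  · intro F hF
    obtain ⟨F', hF', rfl⟩ := Multiset.mem_map.1 hF
    intro u hu v hv huv
    obtain ⟨x, hx, rfl⟩ := Finset.mem_map.1 (Finset.mem_coe.1 hu)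
    obtain ⟨y, hy, rfl⟩ := Finset.mem_map.1 (Finset.mem_coe.1 hv)
    exact hm.1 F' hF' hx hy fun h => huv (h ▸ rfl)
  · by_cases hv : v ∈ T
    · obtain ⟨x, rfl⟩ := hT hv
      have h1 := hm.2 x
      simp only [setWeight, Set.mem_preimage, if_pos hv] at h1 ⊢
      obtain ⟨F, hF, hxF⟩ := Multiset.countP_pos.1 h1
      exact Multiset.countP_pos.2 ⟨F.map e, Multiset.mem_map_of_mem _ hF,
        Finset.mem_map_of_mem _ hxF⟩
    · simp [setWeight, hv]

/-- Minimality bounds all smaller Berge graphs, not only the induced subgraphs of `G`. The graph `H`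
is arbitrary so that this applies after an edit of `G` on the same vertex type. -/
theorem IsMinimumImperfect.perfectOn_of_bergeOn [Fintype V] (hG : G.IsMinimumImperfect)
    {H : SimpleGraph V} {S : Set V} (hS : S ≠ Set.univ) (hH : H.BergeOn S) : H.PerfectOn S := by
  classical
  by_contra hno
  let e : Fin (Fintype.card S) ↪ V :=
    (Fintype.equivFin S).symm.toEmbedding.trans (Function.Embedding.subtype _)
  have hmem : ∀ x, e x ∈ S := fun x => ((Fintype.equivFin S).symm x).2
  have hrange : Set.range e = S := by
    ext v
    constructor
    · rintro ⟨i, rfl⟩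
      exact hmem i
    · intro hv
      exact ⟨Fintype.equivFin S ⟨v, hv⟩, by simp [e]⟩
  have h1 := hG.2.2 _ (H.comap e) (hH.comap_isBerge e hmem)
    fun hp => hno (by
      have := PerfectOn.of_comap e (isPerfectGraph_iff.1 hp)
      rwa [hrange] at this)
  obtain ⟨x, hx⟩ := (Set.ne_univ_iff_exists_notMem S).1 hS
  have h2 := Fintype.card_subtype_lt (p := (· ∈ S)) hx
  have h3 : Fintype.card S = Fintype.card {x // x ∈ S} := rfl
  omega

theorem IsMinimumImperfect.perfectOn [Fintype V] (hG : G.IsMinimumImperfect) {S : Set V}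
    (hS : S ≠ Set.univ) : G.PerfectOn S :=
  hG.perfectOn_of_bergeOn hS (hG.1.bergeOn S)

theorem IsMinimumImperfect.exists_not_cover [Fintype V] (hG : G.IsMinimumImperfect) :
    ∃ k, G.CliqueBound Set.univ k ∧
      ∀ m, G.IsStableCover (setWeight Set.univ) m → m.card ≠ k := by
  have h := hG.2.1
  rw [isPerfectGraph_iff, PerfectOn] at h
  push Not at h
  obtain ⟨T, hT, k, hk, hm⟩ := h
  by_cases hTu : T = Set.univ
  · subst hTu
    exact ⟨k, hk, hm⟩
  · obtain ⟨m, h1, h2⟩ := hG.perfectOn hTu T le_rfl k hk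
    exact absurd h2 (hm m h1)

theorem IsMinimumImperfect.compl [Fintype V] (hG : G.IsMinimumImperfect) : Gᶜ.IsMinimumImperfect := by
  have key : ∀ {W : Type _} [Fintype W] (H : SimpleGraph W), Hᶜ.IsPerfectGraph →
      H.IsPerfectGraph := by
    intro W _ H h
    rw [isPerfectGraph_iff] at h ⊢
    simpa using h.compl
  refine ⟨hG.1.compl, fun h => hG.2.1 (key G h), fun m H hB hP => hG.2.2 m Hᶜ hB.compl fun h => ?_⟩
  rw [isPerfectGraph_iff] at h
  exact hP (isPerfectGraph_iff.2 (by simpa using h.compl))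

theorem cliqueBound_of_separated {A₁ A₂ B S : Set V} (hU : A₁ ∪ A₂ ∪ B = Set.univ)
    (hA : ∀ a ∈ A₁, ∀ b ∈ A₂, a ≠ b ∧ ¬ G.Adj a b) {k : ℕ}
    (h1 : G.CliqueBound (S ∩ (A₁ ∪ B)) k) (h2 : G.CliqueBound (S ∩ (A₂ ∪ B)) k) :
    G.CliqueBound S k := by
  intro t ht hc
  by_cases hex : ∃ a ∈ t, a ∈ A₁
  · obtain ⟨a, hat, ha⟩ := hex
    refine h1 t (fun x hx => ⟨ht hx, ?_⟩) hc
    have hxU : x ∈ A₁ ∪ A₂ ∪ B := hU ▸ Set.mem_univ x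
    rcases hxU with (hx1 | hx2) | hx3
    · exact Or.inl hx1
    · obtain ⟨hne, hn⟩ := hA a ha x hx2
      exact absurd (hc hat hx hne) hn
    · exact Or.inr hx3
  · push Not at hex
    refine h2 t (fun x hx => ⟨ht hx, ?_⟩) hc
    have hxU : x ∈ A₁ ∪ A₂ ∪ B := hU ▸ Set.mem_univ x
    rcases hxU with (hx1 | hx2) | hx3
    · exact absurd hx1 (hex x hx)
    · exact Or.inl hx2
    · exact Or.inr hx3

theorem IsStableCover.add_compl {S : Set V} {m m' : Multiset (Finset V)}
    (h : G.IsStableCover (setWeight S) m) (h' : G.IsStableCover (setWeight Sᶜ) m') :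
    G.IsStableCover (setWeight Set.univ) (m + m') :=
  (h.add h').mono fun v => by by_cases hv : v ∈ S <;> simp [setWeight, hv]

/-- No minimum imperfect graph has a star cutset. -/
theorem IsMinimumImperfect.no_star_cutset [Fintype V] (hG : G.IsMinimumImperfect) {A₁ A₂ B : Set V}
    (hU : A₁ ∪ A₂ ∪ B = Set.univ) (hA : ∀ a ∈ A₁, ∀ b ∈ A₂, a ≠ b ∧ ¬ G.Adj a b)
    (hA₁ : A₁.Nonempty) (hA₂ : A₂.Nonempty) (hd₁ : Disjoint A₁ B) (hd₂ : Disjoint A₂ B)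
    {v : V} (hv : v ∈ B) (hvB : ∀ u ∈ B, u ≠ v → G.Adj v u) : False := by
  classical
  obtain ⟨k, hk, hno⟩ := hG.exists_not_cover
  -- Each side together with `B` is a proper subset, hence has a cover by `k` stable sets; the class
  -- through `v` can be removed from it.
  have hcov : ∀ A A' : Set V, (∀ a ∈ A, ∀ b ∈ A', a ≠ b ∧ ¬ G.Adj a b) → A'.Nonempty →
      Disjoint A' B → ∃ F : Finset V, G.IsIndepSet F ∧ v ∈ F ∧
        G.CliqueBound ((A ∪ B) \ F) (k - 1) := by
    intro A A' hAA hA' hdA'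
    obtain ⟨x, hx⟩ := hA'
    have hx' : x ∉ A ∪ B := by
      rintro (h | h)
      · exact (hAA x h x hx).1 rfl
      · exact Set.disjoint_left.1 hdA' hx h
    obtain ⟨m, hm, hmk⟩ := hG.perfectOn (S := A ∪ B) (fun h => hx' (h ▸ Set.mem_univ x)) _ le_rfl k
      (hk.mono (Set.subset_univ _) le_rfl)
    have h1 := hm.2 v
    simp only [setWeight, if_pos (show v ∈ A ∪ B from Or.inr hv)] at h1
    obtain ⟨F, hF, hvF⟩ := Multiset.countP_pos.1 h1
    obtain ⟨r, rfl⟩ := Multiset.exists_cons_of_mem hF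
    refine ⟨F, hm.1 F hF, hvF, ?_⟩
    have hr : G.IsStableCover (setWeight ((A ∪ B) \ F)) r := by
      refine ⟨fun F' hF' => hm.1 F' (Multiset.mem_cons_of_mem hF'), fun u => ?_⟩
      have h2 := hm.2 u
      rw [Multiset.countP_cons] at h2
      by_cases hu : u ∈ (A ∪ B) \ F
      · have hu1 : u ∉ F := hu.2
        simpa [setWeight, hu.1, hu1] using h2
      · simp [setWeight, hu]
    have := hr.cliqueBound
    rw [Multiset.card_cons] at hmk
    exact this.mono le_rfl (by omega)
  obtain ⟨F₁, hF₁, hvF₁, hb₁⟩ := hcov A₁ A₂ hA hA₂ hd₂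
  obtain ⟨F₂, hF₂, hvF₂, hb₂⟩ := hcov A₂ A₁
    (fun a ha b hb => ⟨(hA b hb a ha).1.symm, fun h => (hA b hb a ha).2 h.symm⟩) hA₁ hd₁
  have hvF : ∀ F : Finset V, G.IsIndepSet F → v ∈ F → ∀ u ∈ B, u ∈ F → u = v := by
    intro F hF hvF u hu huF
    by_contra hne
    exact hF hvF huF (Ne.symm hne) (hvB u hu hne)
  -- Both classes meet `B` only in `v`, so they glue to one stable set whose removal lowers the
  -- clique bound on both sides.
  set F : Finset V := Finset.univ.filter fun x => x ∈ A₁ ∧ x ∈ F₁ ∨ x ∈ A₂ ∧ x ∈ F₂ ∨ x = v with hF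
  have hFmem : ∀ x, x ∈ F ↔ (x ∈ A₁ ∧ x ∈ F₁ ∨ x ∈ A₂ ∧ x ∈ F₂ ∨ x = v) := by
    intro x
    simp [hF]
  have hFi : G.IsIndepSet F := by
    have half : ∀ x ∈ F, ∀ y ∈ F, x ≠ y → x ∈ A₁ → ¬ G.Adj x y := by
      intro x hx y hy hxy hx1
      rw [hFmem] at hx hy
      have hxF : x ∈ F₁ := by
        rcases hx with h | h | h
        · exact h.2
        · exact absurd rfl (hA x hx1 x h.1).1
        · exact h ▸ hvF₁
      rcases hy with h | h | h
      · exact hF₁ hxF h.2 hxy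
      · exact (hA x hx1 y h.1).2
      · subst h
        exact hF₁ hxF hvF₁ hxy
    have half' : ∀ x ∈ F, ∀ y ∈ F, x ≠ y → x ∈ A₂ → ¬ G.Adj x y := by
      intro x hx y hy hxy hx1
      rw [hFmem] at hx hy
      have hxF : x ∈ F₂ := by
        rcases hx with h | h | h
        · exact absurd rfl (hA x h.1 x hx1).1
        · exact h.2
        · exact h ▸ hvF₂
      rcases hy with h | h | h
      · exact fun hadj => (hA y h.1 x hx1).2 hadj.symm
      · exact hF₂ hxF h.2 hxy
      · subst h
        exact hF₂ hxF hvF₂ hxy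
    intro x hx y hy hxy hadj
    rcases (hFmem x).1 hx with h | h | h
    · exact half x hx y hy hxy h.1 hadj
    · exact half' x hx y hy hxy h.1 hadj
    · rcases (hFmem y).1 hy with h' | h' | h'
      · exact half y hy x hx hxy.symm h'.1 hadj.symm
      · exact half' y hy x hx hxy.symm h'.1 hadj.symm
      · exact hxy (h.trans h'.symm)
  have hbF : G.CliqueBound (F : Set V)ᶜ (k - 1) := by
    refine cliqueBound_of_separated hU hA (hb₁.mono ?_ le_rfl) (hb₂.mono ?_ le_rfl)
    · rintro x ⟨hxF, hx⟩
      refine ⟨hx, fun hxF₁ => hxF ?_⟩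
      rw [Finset.mem_coe, hFmem]
      rcases hx with hx | hx
      · exact Or.inl ⟨hx, hxF₁⟩
      · exact Or.inr (Or.inr (hvF F₁ hF₁ hvF₁ x hx hxF₁))
    · rintro x ⟨hxF, hx⟩
      refine ⟨hx, fun hxF₂ => hxF ?_⟩
      rw [Finset.mem_coe, hFmem]
      rcases hx with hx | hx
      · exact Or.inr (Or.inl ⟨hx, hxF₂⟩)
      · exact Or.inr (Or.inr (hvF F₂ hF₂ hvF₂ x hx hxF₂))
  have hvF' : v ∈ F := (hFmem v).2 (Or.inr (Or.inr rfl))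
  obtain ⟨m, hm, hmk⟩ := hG.perfectOn (S := (F : Set V)ᶜ)
    (fun h => (h ▸ Set.mem_univ v : v ∈ (F : Set V)ᶜ) hvF') _ le_rfl _ hbF
  have hk1 : 1 ≤ k := by simpa using hk {v} (Set.subset_univ _) (by simp)
  have hFc : G.IsStableCover (setWeight (F : Set V)) {F} := by
    refine ⟨by simpa using hFi, fun x => ?_⟩
    by_cases hx : x ∈ F
    · have : 1 ≤ Multiset.countP (x ∈ ·) {F} := Multiset.countP_pos.2 ⟨F, by simp, hx⟩
      simpa only [setWeight, Finset.mem_coe, if_pos hx] using this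
    · simp [setWeight, hx]
  refine hno _ (hFc.add_compl hm) ?_
  rw [Multiset.card_add, Multiset.card_singleton, hmk]
  omega

end MinimumImperfect

/-! ### Adding a vertex to one side of a balanced partition. -/

section AddStar

variable {V : Type*} {G : SimpleGraph V} {z : V} {D : Set V}

/-- The graph obtained from `G` by changing the neighbourhood of `z` to `D`. -/
def addStar (G : SimpleGraph V) (z : V) (D : Set V) : SimpleGraph V where
  Adj x y := x ≠ z ∧ y ≠ z ∧ G.Adj x y ∨ x = z ∧ y ≠ z ∧ y ∈ D ∨ y = z ∧ x ≠ z ∧ x ∈ D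
  symm := ⟨by
    rintro x y (⟨h1, h2, h3⟩ | h | h)
    · exact Or.inl ⟨h2, h1, h3.symm⟩
    · exact Or.inr (Or.inr h)
    · exact Or.inr (Or.inl h)⟩
  loopless := ⟨by
    rintro x (⟨_, _, h3⟩ | ⟨h1, h2, _⟩ | ⟨h1, h2, _⟩)
    · exact G.loopless.irrefl x h3
    · exact h2 h1
    · exact h2 h1⟩

theorem addStar_adj_of_ne {x y : V} (hx : x ≠ z) (hy : y ≠ z) :
    (G.addStar z D).Adj x y ↔ G.Adj x y := by
  simp [addStar, hx, hy]

theorem addStar_adj_self {y : V} (hy : y ≠ z) : (G.addStar z D).Adj z y ↔ y ∈ D := by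
  simp [addStar, hy]

theorem addStar_compl_adj_of_ne {x y : V} (hx : x ≠ z) (hy : y ≠ z) :
    (G.addStar z D)ᶜ.Adj x y ↔ Gᶜ.Adj x y := by
  simp [compl_adj, addStar_adj_of_ne hx hy]

theorem addStar_compl_adj_self {y : V} (hy : y ≠ z) :
    (G.addStar z D)ᶜ.Adj z y ↔ y ∉ D := by
  simp [compl_adj, addStar_adj_self hy, hy.symm]

/-- An odd hole through `z`, minus `z`, is an odd path with ends in `D`; its interior avoids `B \
D`, which is complete to both ends. An odd antihole likewise leaves an odd antipath with interior in
`D` and ends in `A`. Both contradict balance. -/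
theorem bergeOn_addStar (hB : G.IsBerge) {A B : Set V} (hD : D ⊆ B)
    (hDB : ∀ x ∈ D, ∀ y ∈ B, y ∉ D → G.Adj x y) (hbal : G.IsBalancedPair A B) :
    (G.addStar z D).BergeOn (insert z (A ∪ B)) := by
  intro f n hn hfS hf
  by_contra hodd
  rw [Nat.not_even_iff_odd] at hodd
  have hn2 := Nat.odd_iff.1 hodd
  by_cases hex : ∃ k < n, f k = z
  swap
  · push Not at hex
    have hcyc : G.IsCycleSeq f n ∨ Gᶜ.IsCycleSeq f n := by
      refine hf.imp (fun hf i j hij hj => ?_) (fun hf i j hij hj => ?_)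
      · rw [← hf i j hij hj, addStar_adj_of_ne (hex i (by omega)) (hex j hj)]
      · rw [← hf i j hij hj, addStar_compl_adj_of_ne (hex i (by omega)) (hex j hj)]
    exact Nat.not_even_iff_odd.2 hodd (hB.bergeOn Set.univ f n hn (fun _ _ => Set.mem_univ _) hcyc)
  obtain ⟨k, hk, hkz⟩ := hex
  obtain ⟨g, hg0, hgS, hg⟩ : ∃ g : ℕ → V, g 0 = z ∧ (∀ i < n, g i ∈ insert z (A ∪ B)) ∧
      ((G.addStar z D).IsCycleSeq g n ∨ (G.addStar z D)ᶜ.IsCycleSeq g n) := by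
    refine ⟨fun i => if i + k < n then f (i + k) else f (i + k - n), by simpa [hk] using hkz,
      fun i hi => ?_, hf.imp (fun h => h.rotate hk) (fun h => h.rotate hk)⟩
    simp only
    split_ifs with h
    · exact hfS _ h
    · exact hfS _ (by omega)
  have hne : ∀ i, 0 < i → i < n → g i ≠ z := by
    intro i hi hin
    rw [← hg0]
    exact (hg.elim (fun h => h.ne hn hi hin) (fun h => h.ne hn hi hin)).symm
  have hgAB : ∀ i, 0 < i → i < n → g i ∈ A ∪ B := fun i hi hin =>
    (hgS i hin).resolve_left (hne i hi hin)
  rcases hg with hg | hg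
  · have hmem : ∀ i, 0 < i → i < n → (g i ∈ D ↔ i = 1 ∨ i + 1 = n) := by
      intro i hi hin
      have := hg 0 i hi hin
      rw [hg0, addStar_adj_self (hne i hi hin)] at this
      rw [this]
      omega
    have hGadj : ∀ i j, 0 < i → i < j → j < n → (G.Adj (g i) (g j) ↔ j = i + 1) := by
      intro i j hi hij hj
      rw [← addStar_adj_of_ne (z := z) (D := D) (hne i hi (by omega)) (hne j (by omega) hj),
        hg i j hij hj]
      omega
    have h1 : g 1 ∈ D := (hmem 1 (by omega) (by omega)).2 (Or.inl rfl)
    have hl : g (n - 1) ∈ D := (hmem (n - 1) (by omega) (by omega)).2 (Or.inr (by omega))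
    have hseq : G.IsPathSeq (fun i => g (i + 1)) (n - 2) := by
      intro i j hij hj
      simp only
      rw [hGadj (i + 1) (j + 1) (by omega) (by omega) (by omega)]
      omega
    have hpath := hseq.hasInducedPath (X := A) (by omega) (by
      intro i hi hin
      refine (hgAB (i + 1) (by omega) (by omega)).resolve_right fun hiB => ?_
      have hiD : g (i + 1) ∉ D := by
        rw [hmem _ (by omega) (by omega)]
        omega
      have e1 := (hGadj 1 (i + 1) one_pos (by omega) (by omega)).1 (hDB _ h1 _ hiB hiD)
      have e2 := (hGadj (i + 1) (n - 1) (by omega) (by omega) (by omega)).1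
        (hDB _ hl _ hiB hiD).symm
      omega)
    have hend : n - 2 + 1 = n - 1 := by omega
    simp only [zero_add, hend] at hpath
    refine hbal.1 (g 1) (hD h1) (g (n - 1)) (hD hl) ?_ (n - 2) (Nat.odd_iff.2 (by omega)) hpath
    rw [hGadj 1 (n - 1) one_pos (by omega) (by omega)]
    omega
  · have hmem : ∀ i, 0 < i → i < n → (g i ∉ D ↔ i = 1 ∨ i + 1 = n) := by
      intro i hi hin
      have := hg 0 i hi hin
      rw [hg0, addStar_compl_adj_self (hne i hi hin)] at this
      rw [this]
      omega
    have hGadj : ∀ i j, 0 < i → i < j → j < n → (Gᶜ.Adj (g i) (g j) ↔ j = i + 1) := by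
      intro i j hi hij hj
      rw [← addStar_compl_adj_of_ne (z := z) (D := D) (hne i hi (by omega)) (hne j (by omega) hj),
        hg i j hij hj]
      omega
    have hin : ∀ i, 1 < i → i + 1 < n → g i ∈ D := by
      intro i hi hin
      by_contra h
      rw [hmem i (by omega) (by omega)] at h
      omega
    have h1 : g 1 ∈ A := by
      refine (hgAB 1 (by omega) (by omega)).resolve_right fun h1B => ?_
      have h2 := hDB _ (hin 2 (by omega) (by omega)) _ h1B
        ((hmem 1 (by omega) (by omega)).2 (Or.inl rfl))
      have h3 := (hGadj 1 2 one_pos (by omega) (by omega)).2 rfl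
      exact (compl_adj ..).1 h3 |>.2 h2.symm
    have hl : g (n - 1) ∈ A := by
      refine (hgAB (n - 1) (by omega) (by omega)).resolve_right fun h1B => ?_
      have h2 := hDB _ (hin (n - 2) (by omega) (by omega)) _ h1B
        ((hmem (n - 1) (by omega) (by omega)).2 (Or.inr (by omega)))
      have h3 := (hGadj (n - 2) (n - 1) (by omega) (by omega) (by omega)).2 (by omega)
      exact (compl_adj ..).1 h3 |>.2 h2
    have hseq : Gᶜ.IsPathSeq (fun i => g (i + 1)) (n - 2) := by
      intro i j hij hj
      simp only
      rw [hGadj (i + 1) (j + 1) (by omega) (by omega) (by omega)]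
      omega
    have hpath := hseq.hasInducedPath (X := B) (by omega) fun i hi hin' =>
      hD (hin (i + 1) (by omega) (by omega))
    have hend : n - 2 + 1 = n - 1 := by omega
    simp only [zero_add, hend] at hpath
    refine hbal.2 (g 1) h1 (g (n - 1)) hl ?_ (n - 2) (Nat.odd_iff.2 (by omega)) hpath
    by_contra hnadj
    have h3 : Gᶜ.Adj (g 1) (g (n - 1)) :=
      (compl_adj ..).2 ⟨hg.ne hn (by omega) (by omega), hnadj⟩
    rw [hGadj 1 (n - 1) one_pos (by omega) (by omega)] at h3
    omega

theorem isClique_addStar {t : Set V} (hz : z ∉ t) :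
    (G.addStar z D).IsClique t ↔ G.IsClique t := by
  constructor
  · intro h x hx y hy hxy
    exact (addStar_adj_of_ne (by rintro rfl; exact hz hx) (by rintro rfl; exact hz hy)).1
      (h hx hy hxy)
  · intro h x hx y hy hxy
    exact (addStar_adj_of_ne (by rintro rfl; exact hz hx) (by rintro rfl; exact hz hy)).2
      (h hx hy hxy)

/-- If the graph with the additional star is perfect, then `S'` has a subset disjoint from `D` such
that the clique bound splits between it and the rest of `S'`. -/
theorem exists_split [Fintype V] {S S' : Set V}
    (hH : (G.addStar z D).PerfectOn (insert z S)) (hS' : S' ⊆ S) (hzS : z ∉ S) {r d k : ℕ}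
    (hk : r + d ≤ k) (hd : G.CliqueBound D d) (hkS : G.CliqueBound S' k) :
    ∃ T ⊆ S', Disjoint T D ∧ G.CliqueBound T r ∧ G.CliqueBound (S' \ T) (k - r) := by
  classical
  have hzS' : z ∉ S' := fun h => hzS (hS' h)
  -- Taking `r` copies of `z` keeps the clique bound `k`, because the rest of a clique through `z`
  -- lies in `D`. The `r` classes through `z` selected below avoid `D`, and `T` is what they cover
  -- of `S'`.
  obtain ⟨m, hm, hmk⟩ := hH.exists_stableCover (w := fun v => if v = z then r else setWeight S' v)
    (k := k) (by
      intro v hv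
      have h1 : v ≠ z := fun h => hv (Or.inl h)
      have h2 : v ∉ S' := fun h => hv (Or.inr (hS' h))
      simp [h1, setWeight, h2]) (by
      intro t ht
      have hsum : ∀ t : Finset V, z ∉ t →
          ∑ v ∈ t, (if v = z then r else setWeight S' v) = (t.filter (· ∈ S')).card := by
        intro t hzt
        rw [Finset.card_filter]
        refine Finset.sum_congr rfl fun v hv => ?_
        rw [if_neg (by rintro rfl; exact hzt hv)]
        rfl
      by_cases hzt : z ∈ t
      · rw [← Finset.add_sum_erase _ _ hzt, if_pos rfl, hsum _ (Finset.notMem_erase _ _)]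
        have hsub : t.erase z ⊆ t := Finset.erase_subset _ _
        have h1 : (t.erase z).card ≤ d := by
          refine hd _ (fun v hv => ?_)
            ((isClique_addStar (D := D) (by simp)).1 (ht.subset (by exact_mod_cast hsub)))
          have hv' := Finset.mem_erase.1 (Finset.mem_coe.1 hv)
          exact (addStar_adj_self hv'.1).1 (ht hzt hv'.2 hv'.1.symm)
        have h2 := Finset.card_filter_le (t.erase z) (· ∈ S')
        omega
      · rw [hsum t hzt]
        refine hkS _ (fun v hv => (Finset.mem_filter.1 (Finset.mem_coe.1 hv)).2) ?_
        exact ((isClique_addStar hzt).1 ht).subset (Finset.filter_subset _ _))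
  have hzr : r ≤ (m.filter (z ∈ ·)).card := by
    have := hm.2 z
    simp only [↓reduceIte] at this
    rwa [Multiset.countP_eq_card_filter] at this
  obtain ⟨p, hp⟩ : ∃ p, p ∈ Multiset.powersetCard r (m.filter (z ∈ ·)) := by
    rw [← Multiset.card_pos_iff_exists_mem, Multiset.card_powersetCard]
    exact Nat.choose_pos hzr
  obtain ⟨hpm, hpr⟩ := Multiset.mem_powersetCard.1 hp
  have hpz : ∀ F ∈ p, z ∈ F := fun F hF => (Multiset.mem_filter.1 (Multiset.mem_of_le hpm hF)).2
  obtain ⟨q, rfl⟩ := Multiset.le_iff_exists_add.1 (hpm.trans (Multiset.filter_le _ _))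
  set T : Set V := {v | v ∈ S' ∧ ∃ F ∈ p, v ∈ F} with hT
  have hne : ∀ v ∈ S', v ≠ z := fun v hv h => hzS' (h ▸ hv)
  have toG : ∀ X ⊆ S', ∀ l, (G.addStar z D).CliqueBound X l → G.CliqueBound X l :=
    fun X hX l h t ht hc => h t ht ((isClique_addStar fun hzt => hzS' (hX (ht hzt))).2 hc)
  refine ⟨T, fun v hv => hv.1, ?_, ?_, ?_⟩
  · refine Set.disjoint_left.2 fun v hv hvD => ?_
    obtain ⟨hvS, F, hF, hvF⟩ := hv
    exact hm.1 F (Multiset.mem_add.2 (Or.inl hF)) (hpz F hF) hvF (hne v hvS).symm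
      ((addStar_adj_self (hne v hvS)).2 hvD)
  · have hc : (G.addStar z D).IsStableCover (setWeight T) p := by
      refine ⟨fun F hF => hm.1 F (Multiset.mem_add.2 (Or.inl hF)), fun v => ?_⟩
      by_cases hv : v ∈ T
      · simp only [setWeight, if_pos hv]
        exact Multiset.countP_pos.2 hv.2
      · simp [setWeight, hv]
    exact hpr ▸ toG T (fun v hv => hv.1) _ hc.cliqueBound
  · have hc : (G.addStar z D).IsStableCover (setWeight (S' \ T)) q := by
      refine ⟨fun F hF => hm.1 F (Multiset.mem_add.2 (Or.inr hF)), fun v => ?_⟩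
      by_cases hv : v ∈ S' \ T
      · have h1 := hm.2 v
        simp only at h1
        rw [if_neg (hne v hv.1), Multiset.countP_add] at h1
        have h2 : p.countP (v ∈ ·) = 0 := by
          rw [Multiset.countP_eq_zero]
          intro F hF hvF
          exact hv.2 ⟨hv.1, F, hF, hvF⟩
        simp only [setWeight, if_pos hv, if_pos hv.1] at h1 ⊢
        omega
      · simp [setWeight, hv]
    rw [Multiset.card_add] at hmk
    exact (toG _ Set.sdiff_subset _ hc.cliqueBound).mono le_rfl (by omega)

theorem exists_cliqueBound_and_clique [Fintype V] (G : SimpleGraph V) (D : Set V) :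
    ∃ d, G.CliqueBound D d ∧ ∃ K : Finset V, ↑K ⊆ D ∧ G.IsClique K ∧ K.card = d := by
  classical
  obtain ⟨K, hK, hmax⟩ := Finset.exists_max_image
    ((Finset.univ : Finset (Finset V)).filter fun K : Finset V =>
      (K : Set V) ⊆ D ∧ G.IsClique (K : Set V))
    Finset.card ⟨∅, by simp⟩
  simp only [Finset.mem_filter, Finset.mem_univ, true_and] at hK hmax
  exact ⟨K.card, fun t ht hc => hmax t ⟨ht, hc⟩, K, hK.1, hK.2, rfl⟩

theorem IsMinimumImperfect.not_balanced_part [Fintype V] (hG : G.IsMinimumImperfect)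
    {A₁ A₂ D E : Set V} (hU : A₁ ∪ A₂ ∪ (D ∪ E) = Set.univ)
    (hA : ∀ a ∈ A₁, ∀ b ∈ A₂, a ≠ b ∧ ¬ G.Adj a b) (hDE : ∀ x ∈ D, ∀ y ∈ E, G.Adj x y)
    (hd₁ : Disjoint A₁ (D ∪ E)) (hd₂ : Disjoint A₂ (D ∪ E)) (hA₁ : A₁.Nonempty)
    (hA₂ : A₂.Nontrivial) (hD : D.Nonempty) (hE : E.Nonempty)
    (hbal : G.IsBalancedPair A₁ (D ∪ E)) : False := by
  classical
  obtain ⟨k, hk, hno⟩ := hG.exists_not_cover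
  obtain ⟨z, hz, z', hz', hzz'⟩ := hA₂
  have hDE' : ∀ x, x ∈ D → x ∉ E := fun x hx hx' => G.loopless.irrefl x (hDE x hx x hx')
  have hz_notMem : ∀ y ∈ A₂, y ∉ A₁ ∪ (D ∪ E) := by
    rintro y hy (h | h)
    · exact (hA y h y hy).1 rfl
    · exact Set.disjoint_left.1 hd₂ hy h
  -- A vertex `z` of `A₂` is reused as the new vertex; the second vertex `z'` keeps the edited graph
  -- smaller than `G`.
  have hproper : insert z (A₁ ∪ (D ∪ E)) ≠ Set.univ := by
    intro h
    have : z' ∈ insert z (A₁ ∪ (D ∪ E)) := h ▸ Set.mem_univ z'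
    rcases this with h' | h'
    · exact hzz' h'.symm
    · exact hz_notMem z' hz' h'
  have hPD : (G.addStar z D).PerfectOn (insert z (A₁ ∪ (D ∪ E))) :=
    hG.perfectOn_of_bergeOn hproper (bergeOn_addStar hG.1 Set.subset_union_left
      (fun x hx y hy hyD => hDE x hx y (hy.resolve_left hyD)) hbal)
  have hPE : (G.addStar z E).PerfectOn (insert z (A₁ ∪ (D ∪ E))) :=
    hG.perfectOn_of_bergeOn hproper (bergeOn_addStar hG.1 Set.subset_union_right
      (fun x hx y hy hyE => (hDE y (hy.resolve_right hyE) x hx).symm) hbal)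
  obtain ⟨a₁, ha₁⟩ := hA₁
  obtain ⟨m, hm, hmk⟩ := hG.perfectOn (S := A₂ ∪ (D ∪ E)) (by
    intro h
    have : a₁ ∈ A₂ ∪ (D ∪ E) := h ▸ Set.mem_univ a₁
    rcases this with h' | h'
    · exact (hA a₁ ha₁ a₁ h').1 rfl
    · exact Set.disjoint_left.1 hd₁ ha₁ h') _ le_rfl k (hk.mono (Set.subset_univ _) le_rfl)
  -- `D` is complete to `E`, so the classes meeting `D` avoid `E`. The numbers of classes of the two
  -- kinds are the targets for the `A₁` side.
  set mD := m.filter fun F => ∃ v ∈ D, v ∈ F with hmD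
  set mE := m.filter fun F => ¬ ∃ v ∈ D, v ∈ F with hmE
  have hsplit : mD + mE = m := Multiset.filter_add_not _ _
  have hcard : mD.card + mE.card = k := by rw [← Multiset.card_add, hsplit, hmk]
  set X₂ : Set V := {v | v ∈ A₂ ∧ ∃ F ∈ mD, v ∈ F} ∪ D with hX₂
  have hex : ∀ v ∈ A₂ ∪ (D ∪ E), ∃ F ∈ m, v ∈ F := by
    intro v hv
    have := hm.2 v
    simp only [setWeight, if_pos hv] at this
    exact Multiset.countP_pos.1 this
  have hX₂b : G.CliqueBound X₂ mD.card := by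
    refine IsStableCover.cliqueBound ⟨fun F hF => hm.1 F (Multiset.mem_filter.1 hF).1, fun v => ?_⟩
    by_cases hv : v ∈ X₂
    · simp only [setWeight, if_pos hv]
      refine Multiset.countP_pos.2 ?_
      rcases hv with hv | hv
      · exact hv.2
      · obtain ⟨F, hF, hvF⟩ := hex v (Or.inr (Or.inl hv))
        exact ⟨F, Multiset.mem_filter.2 ⟨hF, v, hv, hvF⟩, hvF⟩
    · simp [setWeight, hv]
  have hY₂b : G.CliqueBound ((A₂ \ X₂) ∪ E) mE.card := by
    refine IsStableCover.cliqueBound ⟨fun F hF => hm.1 F (Multiset.mem_filter.1 hF).1, fun v => ?_⟩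
    by_cases hv : v ∈ (A₂ \ X₂) ∪ E
    · simp only [setWeight, if_pos hv]
      refine Multiset.countP_pos.2 ?_
      rcases hv with hv | hv
      · obtain ⟨F, hF, hvF⟩ := hex v (Or.inl hv.1)
        refine ⟨F, Multiset.mem_filter.2 ⟨hF, fun hFD => hv.2 (Or.inl ⟨hv.1, F, ?_, hvF⟩)⟩, hvF⟩
        exact Multiset.mem_filter.2 ⟨hF, hFD⟩
      · obtain ⟨F, hF, hvF⟩ := hex v (Or.inr (Or.inr hv))
        refine ⟨F, Multiset.mem_filter.2 ⟨hF, ?_⟩, hvF⟩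
        rintro ⟨u, huD, huF⟩
        exact hm.1 F hF huF hvF (fun h => hDE' u huD (h ▸ hv)) (hDE u huD v hv)
    · simp [setWeight, hv]
  obtain ⟨d, hdb, K, hKD, hKc, hKd⟩ := exists_cliqueBound_and_clique G D
  have hdm : d ≤ mD.card := hKd ▸ hX₂b K (hKD.trans Set.subset_union_right) hKc
  have hS := hz_notMem z hz
  -- Keep only `d` colours, the clique number of `D`, outside `T₁`. A vertex of `E` left there would
  -- extend a maximum clique of `D` to `d + 1` vertices, so `E ⊆ T₁`.
  obtain ⟨T₁, hT₁S, hT₁D, hT₁b, hT₁b'⟩ := exists_split hPD le_rfl hS (r := k - d) (d := d) (k := k)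
    (by omega) hdb (hk.mono (Set.subset_univ _) le_rfl)
  have hET₁ : E ⊆ T₁ := by
    intro x hx
    by_contra hxT
    have hxK : x ∉ K := fun h => hDE' x (hKD h) hx
    have := hT₁b' (insert x K) (by
      intro y hy
      rw [Finset.coe_insert] at hy
      rcases hy with rfl | hy
      · exact ⟨Or.inr (Or.inr hx), hxT⟩
      · exact ⟨Or.inr (Or.inl (hKD hy)), fun h => Set.disjoint_left.1 hT₁D h (hKD hy)⟩) (by
      rw [Finset.coe_insert]
      exact hKc.insert fun y hy _ => (hDE y (hKD hy) x hx).symm)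
    rw [Finset.card_insert_of_notMem hxK] at this
    omega
  -- The second split returns the missing `mD.card - d` colours to the part with `D`, taking no
  -- vertex of `E`; exactly `mE.card` remain for the rest of `T₁`.
  obtain ⟨T₂, hT₂T, hT₂E, hT₂b, hT₂b'⟩ := exists_split hPE hT₁S hS (r := mD.card - d)
    (d := mE.card) (k := k - d) (by omega) (hY₂b.mono Set.subset_union_right le_rfl) hT₁b
  set X : Set V := (((A₁ ∪ (D ∪ E)) \ T₁) ∪ T₂) ∪ X₂ with hX
  have hDX : D ⊆ X := fun v hv => Or.inr (Or.inr hv)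
  have hEX : ∀ v ∈ E, v ∉ X := by
    rintro v hv ((h | h) | (h | h))
    · exact h.2 (hET₁ hv)
    · exact Set.disjoint_left.1 hT₂E h hv
    · exact Set.disjoint_left.1 hd₂ h.1 (Or.inr hv)
    · exact hDE' v h hv
  -- On the `A₁` side the bound is `d + (mD.card - d)`; on the `A₂` side `X` meets `A₂ ∪ (D ∪ E)`
  -- inside `X₂`.
  have hXb : G.CliqueBound X mD.card := by
    refine cliqueBound_of_separated hU hA ?_ ?_
    · refine (hT₁b'.union hT₂b).mono ?_ (by omega)
      rintro v ⟨h | (h | h), hv⟩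
      · exact h
      · rcases hv with hv | hv
        · exact absurd rfl (hA v hv v h.1).1
        · exact absurd hv (Set.disjoint_left.1 hd₂ h.1)
      · exact Or.inl ⟨Or.inr (Or.inl h), fun hT => Set.disjoint_left.1 hT₁D hT h⟩
    · refine hX₂b.mono ?_ le_rfl
      rintro v ⟨hvX, hv⟩
      rcases hv with hv | hv | hv
      · rcases hvX with (h | h) | h
        · exact absurd h.1 (hz_notMem v hv)
        · exact absurd (hT₁S (hT₂T h)) (hz_notMem v hv)
        · exact h
      · exact Or.inr hv
      · exact absurd hvX (hEX v hv)
  have hXb' : G.CliqueBound Xᶜ mE.card := by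
    refine cliqueBound_of_separated hU hA ?_ ?_
    · refine hT₂b'.mono ?_ (by omega)
      rintro v ⟨hvX, hv⟩
      refine ⟨?_, fun h => hvX (Or.inl (Or.inr h))⟩
      by_contra hT
      exact hvX (Or.inl (Or.inl ⟨hv, hT⟩))
    · refine hY₂b.mono ?_ le_rfl
      rintro v ⟨hvX, hv⟩
      rcases hv with hv | hv | hv
      · exact Or.inl ⟨hv, fun h => hvX (Or.inr h)⟩
      · exact absurd (hDX hv) hvX
      · exact Or.inr hv
  obtain ⟨x, hx⟩ := hD
  obtain ⟨y, hy⟩ := hE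
  obtain ⟨p, hp, hpk⟩ := hG.perfectOn (S := X) (fun h => hEX y hy (h ▸ Set.mem_univ y)) _ le_rfl _
    hXb
  obtain ⟨q, hq, hqk⟩ := hG.perfectOn (S := Xᶜ) (fun h =>
    (show x ∉ Xᶜ from fun h' => h' (hDX hx)) (h ▸ Set.mem_univ x)) _ le_rfl _ hXb'
  exact hno _ (hp.add_compl hq) (by rw [Multiset.card_add, hpk, hqk, hcard])

end AddStar

/-! ### Components, anticomponents and the existence of pairs. -/

section Components

variable {V : Type*} {G : SimpleGraph V}

theorem IsConnectedSet.subset_of_separated {X C : Set V} (hX : G.IsConnectedSet X)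
    (hne : (X ∩ C).Nonempty) (hsep : ∀ a ∈ C, ∀ b ∈ X, b ∉ C → ¬ G.Adj a b) : X ⊆ C := by
  obtain ⟨x, hxX, hxC⟩ := hne
  intro y hy
  obtain ⟨w⟩ := hX ⟨x, hxX⟩ ⟨y, hy⟩
  have key : ∀ (u v : X), (G.induce X).Walk u v → u.1 ∈ C → v.1 ∈ C := by
    intro u v w
    induction w with
    | nil => exact id
    | @cons u v' _ h _ ih =>
      intro hu
      refine ih ?_
      by_contra hv
      exact hsep u.1 hu v'.1 v'.2 hv h
  exact key _ _ w hxC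

theorem isConnectedSet_singleton (x : V) : G.IsConnectedSet {x} := by
  rintro ⟨a, rfl⟩ ⟨b, rfl⟩
  exact Reachable.refl _

theorem IsConnectedSet.insert_of_adj {C : Set V} (hC : G.IsConnectedSet C) {c x : V} (hc : c ∈ C)
    (hcx : G.Adj c x) : G.IsConnectedSet (insert x C) := by
  have hmap : ∀ a (ha : a ∈ C), (G.induce (insert x C)).Reachable ⟨c, Or.inr hc⟩ ⟨a, Or.inr ha⟩ :=
    fun a ha => (hC ⟨c, hc⟩ ⟨a, ha⟩).map (induceHomOfLE G (Set.subset_insert x C)).toHom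
  have hall : ∀ a : (insert x C : Set V),
      (G.induce (insert x C)).Reachable ⟨c, Or.inr hc⟩ a := by
    rintro ⟨a, rfl | ha⟩
    · exact Adj.reachable (by exact hcx)
    · exact hmap a ha
  exact fun a b => (hall a).symm.trans (hall b)

theorem isComponent_iff {A C : Set V} :
    G.IsComponent A C ↔ C ⊆ A ∧ C.Nonempty ∧ G.IsConnectedSet C ∧
      ∀ a ∈ C, ∀ b ∈ A, b ∉ C → ¬ G.Adj a b := by
  constructor
  · rintro ⟨⟨x, hx⟩, ⟨hCA, hC⟩, hmax⟩
    refine ⟨hCA, ?_, hC, fun a ha b hb hbC hab => hbC ?_⟩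
    · by_contra hne
      rw [Set.not_nonempty_iff_eq_empty] at hne
      have := hmax (y := {x}) ⟨by simpa using hx, isConnectedSet_singleton x⟩ (by simp [hne])
        (Set.mem_singleton x)
      simp [hne] at this
    · exact hmax (y := insert b C) ⟨Set.insert_subset hb hCA, hC.insert_of_adj ha hab⟩
        (Set.subset_insert b C) (Set.mem_insert b C)
  · rintro ⟨hCA, hne, hC, hsep⟩
    refine ⟨hne.mono hCA, ⟨hCA, hC⟩, fun X ⟨hXA, hX⟩ hCX => ?_⟩
    refine hX.subset_of_separated ?_ fun a ha b hb hbC => hsep a ha b (hXA hb) hbC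
    rwa [Set.inter_eq_right.2 hCX]

theorem exists_isComponent_mem [Finite V] {A : Set V} {a : V} (ha : a ∈ A) :
    ∃ C, G.IsComponent A C ∧ a ∈ C := by
  obtain ⟨C, hle, hC⟩ := (Set.toFinite {X : Set V | X ⊆ A ∧ G.IsConnectedSet X}).exists_le_maximal
    (a := {a}) ⟨by simpa using ha, isConnectedSet_singleton a⟩
  exact ⟨C, ⟨⟨a, ha⟩, hC⟩, hle rfl⟩

theorem nonempty_of_not_isConnectedSet {A : Set V} (hA : ¬ G.IsConnectedSet A) : A.Nonempty := by
  by_contra hne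
  rw [Set.not_nonempty_iff_eq_empty] at hne
  subst hne
  exact hA fun a => a.2.elim

theorem IsComponent.sdiff_nonempty {A C : Set V} (hC : G.IsComponent A C)
    (hA : ¬ G.IsConnectedSet A) : (A \ C).Nonempty := by
  rw [Set.sdiff_nonempty]
  intro hAC
  obtain ⟨hCA, -, hCc, -⟩ := isComponent_iff.1 hC
  exact hA (hAC.antisymm hCA ▸ hCc)

theorem IsComponent.not_isConnectedSet {A C : Set V} (hC : G.IsComponent A C)
    (h : (A \ C).Nonempty) : ¬ G.IsConnectedSet A := by
  obtain ⟨hCA, hne, -, hsep⟩ := isComponent_iff.1 hC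
  intro hA
  obtain ⟨x, hxA, hxC⟩ := h
  exact hxC (hA.subset_of_separated (by rwa [Set.inter_eq_right.2 hCA]) hsep hxA)

theorem IsComponent.ne_and_not_adj {A C C' : Set V} (hC : G.IsComponent A C)
    (hC' : G.IsComponent A C') (hne : C ≠ C') :
    ∀ x ∈ C, ∀ y ∈ C', x ≠ y ∧ ¬ G.Adj x y := by
  obtain ⟨hCA, -, hCc, hsep⟩ := isComponent_iff.1 hC
  obtain ⟨hCA', -, hCc', hsep'⟩ := isComponent_iff.1 hC'
  have hdis : ∀ x ∈ C, x ∉ C' := by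
    intro x hx hx'
    refine hne (Set.Subset.antisymm ?_ ?_)
    · exact hCc.subset_of_separated ⟨x, hx, hx'⟩ fun a ha b hb => hsep' a ha b (hCA hb)
    · exact hCc'.subset_of_separated ⟨x, hx', hx⟩ fun a ha b hb => hsep a ha b (hCA' hb)
  intro x hx y hy
  exact ⟨fun h => hdis x hx (h ▸ hy), hsep x hx y (hCA' hy) fun h => hdis y h hy⟩

theorem IsSkewPartition.compl {A B : Set V} (h : G.IsSkewPartition A B) :
    Gᶜ.IsSkewPartition B A := by
  refine ⟨h.1.symm, by rw [Set.union_comm]; exact h.2.1, h.2.2.2, ?_⟩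
  rw [IsAnticonnectedSet, compl_compl]
  exact h.2.2.1

theorem HasInducedPath.ne {n : ℕ} {u v : V} {X : Set V} (h : G.HasInducedPath n u v X)
    (hn : Odd n) : u ≠ v := by
  obtain ⟨p, rfl, rfl, -⟩ := h
  intro heq
  have := p.injective heq
  rw [Fin.ext_iff] at this
  simp at this
  rw [← this] at hn
  simp at hn

/-- Passing from nonadjacent in `Gᶜ` to adjacent in `G` needs distinct ends, which odd length
supplies. -/
theorem isPathPair_compl {X Y : Set V} : Gᶜ.IsPathPair X Y ↔ G.IsAntipathPair Y X := by
  constructor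
  · rintro ⟨u, hu, v, hv, huv, n, hn, hp⟩
    refine ⟨u, hu, v, hv, ?_, n, hn, hp⟩
    by_contra hadj
    exact huv ((compl_adj ..).2 ⟨hp.ne hn, hadj⟩)
  · rintro ⟨u, hu, v, hv, huv, n, hn, hp⟩
    exact ⟨u, hu, v, hv, fun h => ((compl_adj ..).1 h).2 huv, n, hn, hp⟩

theorem isAntipathPair_compl {X Y : Set V} : Gᶜ.IsAntipathPair X Y ↔ G.IsPathPair Y X := by
  rw [← isPathPair_compl, compl_compl]

theorem isComponent_compl {A C : Set V} : Gᶜ.IsComponent A C ↔ G.IsAnticomponent A C := Iff.rfl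

theorem isAnticomponent_compl {A C : Set V} : Gᶜ.IsAnticomponent A C ↔ G.IsComponent A C := by
  rw [← isComponent_compl, compl_compl]

theorem IsPathSeq.mem_of_separated {f : ℕ → V} {n : ℕ} (h : G.IsPathSeq f n) {A C : Set V}
    (hsep : ∀ a ∈ C, ∀ b ∈ A, b ∉ C → ¬ G.Adj a b) (hfA : ∀ i, 0 < i → i < n → f i ∈ A)
    (h1 : f 1 ∈ C) : ∀ i, 0 < i → i < n → f i ∈ C := by
  intro i
  induction i with
  | zero => intro h0; omega
  | succ i ih =>
    intro _ hin
    rcases Nat.eq_zero_or_pos i with rfl | hi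
    · exact h1
    · by_contra hno
      exact hsep _ (ih hi (by omega)) _ (hfA _ (by omega) hin) hno
        ((h i (i + 1) (by omega) (by omega)).2 rfl)

/-- Distinct nonadjacent vertices of `B` lie in the same anticomponent. -/
theorem HasInducedPath.isPathPair_of_subset [Finite V] {A B : Set V} {n : ℕ} {u v : V}
    (hp : G.HasInducedPath n u v A) (hu : u ∈ B) (hv : v ∈ B) (huv : ¬ G.Adj u v) (hn : Odd n) :
    ∃ D, G.IsAnticomponent B D ∧ G.IsPathPair A D := by
  obtain ⟨D, hD, huD⟩ := exists_isComponent_mem (G := Gᶜ) hu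
  refine ⟨D, hD, u, huD, v, ?_, huv, n, hn, hp⟩
  by_contra hvD
  exact (isComponent_iff.1 hD).2.2.2 u huD v hv hvD ((compl_adj ..).2 ⟨hp.ne hn, huv⟩)

/-- The interior is connected; it is nonempty because the ends are nonadjacent. -/
theorem HasInducedPath.exists_component [Finite V] {A : Set V} {n : ℕ} {u v : V}
    (hp : G.HasInducedPath n u v A) (hn : Odd n) (huv : ¬ G.Adj u v) :
    ∃ C, G.IsComponent A C ∧ G.HasInducedPath n u v C := by
  obtain ⟨f, hf, rfl, rfl, hfA⟩ := hp.exists_isPathSeq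
  have hn3 : 3 ≤ n := by
    have := Nat.odd_iff.1 hn
    by_contra hlt
    obtain rfl : n = 1 := by omega
    exact huv ((hf 0 1 one_pos le_rfl).2 rfl)
  obtain ⟨C, hC, h1C⟩ := exists_isComponent_mem (G := G) (hfA 1 one_pos (by omega))
  exact ⟨C, hC, hf.hasInducedPath hn3
    (hf.mem_of_separated (isComponent_iff.1 hC).2.2.2 hfA h1C)⟩

theorem IsMinimumImperfect.exists_pair_of_isComponent [Fintype V] (hG : G.IsMinimumImperfect)
    {A B C : Set V} (hAB : G.IsSkewPartition A B) (hC : G.IsComponent A C) :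
    ∃ D, G.IsAnticomponent B D ∧ (G.IsPathPair C D ∨ G.IsAntipathPair C D) := by
  by_contra hno
  push Not at hno
  obtain ⟨hdis, hU, hA, hB⟩ := hAB
  obtain ⟨hCA, hCne, -, hCsep⟩ := isComponent_iff.1 hC
  obtain ⟨b, hb⟩ := nonempty_of_not_isConnectedSet hB
  obtain ⟨D, hD, -⟩ := exists_isComponent_mem (G := Gᶜ) hb
  obtain ⟨hDB, hDne, -, hDsep⟩ := isComponent_iff.1 hD
  have hsepC : ∀ a ∈ C, ∀ b ∈ A \ C, a ≠ b ∧ ¬ G.Adj a b := fun a ha b hb =>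
    ⟨fun h => hb.2 (h ▸ ha), hCsep a ha b hb.1 hb.2⟩
  have hsepD : ∀ a ∈ D, ∀ b ∈ B \ D, a ≠ b ∧ ¬ Gᶜ.Adj a b := fun a ha b hb =>
    ⟨fun h => hb.2 (h ▸ ha), hDsep a ha b hb.1 hb.2⟩
  have hUC : C ∪ A \ C = A := Set.union_sdiff_cancel hCA
  have hUD : D ∪ B \ D = B := Set.union_sdiff_cancel hDB
  obtain ⟨a, ha⟩ := hC.sdiff_nonempty hA
  by_cases hnt : (A \ C).Nontrivial
  · refine hG.not_balanced_part (A₁ := C) (A₂ := A \ C) (D := D) (E := B \ D) ?_ hsepC ?_ ?_ ?_ hCne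
      hnt hDne (hD.sdiff_nonempty hB) ?_
    · rw [hUC, hUD, hU]
    · intro x hx y hy
      obtain ⟨hne, hadj⟩ := hsepD x hx y hy
      by_contra hn
      exact hadj ((compl_adj ..).2 ⟨hne, hn⟩)
    · rw [hUD]
      exact hdis.mono_left hCA
    · rw [hUD]
      exact hdis.mono_left Set.sdiff_subset
    · rw [hUD]
      refine ⟨fun u hu v hv huv n hn hp => ?_, fun u hu v hv huv n hn hp => ?_⟩
      · obtain ⟨D', hD', hpair⟩ := hp.isPathPair_of_subset hu hv huv hn
        exact (hno D' hD').1 hpair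
      · obtain ⟨D', hD', hp'⟩ := HasInducedPath.exists_component hp hn
          fun h => ((compl_adj ..).1 h).2 huv
        exact (hno D' hD').2 ⟨u, hu, v, hv, huv, n, hn, hp'⟩
  -- Here `A \ C = {a}`, and in the complement `a` is adjacent to all of `C`: `A` is a star cutset
  -- there, separating `D` from `B \ D`.
  · rw [Set.not_nontrivial_iff] at hnt
    refine hG.compl.no_star_cutset (A₁ := D) (A₂ := B \ D) (B := A) ?_ hsepD hDne
      (hD.sdiff_nonempty hB) ?_ ?_ ha.1 ?_
    · rw [hUD, Set.union_comm, hU]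
    · exact hdis.symm.mono_left hDB
    · exact hdis.symm.mono_left Set.sdiff_subset
    · intro u hu hua
      have huC : u ∈ C := by
        by_contra h
        exact hua (hnt ⟨hu, h⟩ ha)
      obtain ⟨hne, hadj⟩ := hsepC u huC a ha
      exact (compl_adj ..).2 ⟨hne.symm, fun h => hadj h.symm⟩

theorem IsMinimumImperfect.exists_pair_of_isAnticomponent [Fintype V] (hG : G.IsMinimumImperfect)
    {A B D : Set V} (hAB : G.IsSkewPartition A B) (hD : G.IsAnticomponent B D) :
    ∃ C, G.IsComponent A C ∧ (G.IsPathPair C D ∨ G.IsAntipathPair C D) := by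
  obtain ⟨C, hC, hp⟩ := hG.compl.exists_pair_of_isComponent hAB.compl hD
  rw [isAnticomponent_compl] at hC
  rw [isPathPair_compl, isAntipathPair_compl] at hp
  exact ⟨C, hC, hp.symm⟩

theorem HasInducedPath.mono {n : ℕ} {u v : V} {X Y : Set V} (h : G.HasInducedPath n u v X)
    (hXY : X ⊆ Y) : G.HasInducedPath n u v Y := by
  obtain ⟨p, hu, hv, hp⟩ := h
  exact ⟨p, hu, hv, fun i hi hi' => hXY (hp i hi hi')⟩

theorem IsMinimumImperfect.not_isBalancedPair [Fintype V] (hG : G.IsMinimumImperfect)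
    {A B : Set V} (hAB : G.IsSkewPartition A B) : ¬ G.IsBalancedPair A B := by
  intro hbal
  obtain ⟨a, ha⟩ := nonempty_of_not_isConnectedSet hAB.2.2.1
  obtain ⟨C, hC, -⟩ := exists_isComponent_mem (G := G) ha
  obtain ⟨D, hD, hp⟩ := hG.exists_pair_of_isComponent hAB hC
  have hCA := (isComponent_iff.1 hC).1
  have hDB := (isComponent_iff.1 hD).1
  rcases hp with ⟨u, hu, v, hv, huv, n, hn, hp⟩ | ⟨u, hu, v, hv, huv, n, hn, hp⟩
  · exact hbal.1 u (hDB hu) v (hDB hv) huv n hn (hp.mono hCA)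
  · exact hbal.2 u (hCA hu) v (hCA hv) huv n hn (HasInducedPath.mono hp hDB)

end Components

/-! ### Loose skew partitions. -/

section LoosePartitions

variable {V : Type*} {G : SimpleGraph V}

theorem IsPathSeq.shift {f : ℕ → V} {n s t : ℕ} (h : G.IsPathSeq f n) (ht : t ≤ n) :
    G.IsPathSeq (fun i => f (s + i)) (t - s) := by
  intro i j hij hj
  simp only
  rw [h (s + i) (s + j) (by omega) (by omega)]
  omega

theorem IsPathSeq.three_le {f : ℕ → V} {n : ℕ} (h : G.IsPathSeq f n) (hn : Odd n)
    (hadj : ¬ G.Adj (f 0) (f n)) : 3 ≤ n := by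
  have := Nat.odd_iff.1 hn
  by_contra hlt
  obtain rfl : n = 1 := by omega
  exact hadj ((h 0 1 one_pos le_rfl).2 rfl)

/-- A vertex adjacent to exactly the two ends of a path closes a hole. -/
theorem IsBerge.even_of_fan (hB : G.IsBerge) {f : ℕ → V} {n : ℕ} (hf : G.IsPathSeq f n)
    (hn : 2 ≤ n) {v : V} (hv : ∀ i ≤ n, G.Adj (f i) v ↔ i = 0 ∨ i = n) : Even n := by
  by_contra hodd
  rw [Nat.not_even_iff_odd, Nat.odd_iff] at hodd
  have := hB.even_cycle (f := fun i => if i ≤ n then f i else v) (n := n + 2) (by omega) (by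
    intro i j hij hj
    simp only
    rw [if_pos (by omega)]
    split_ifs with h
    · rw [hf i j hij h]
      omega
    · rw [hv i (by omega)]
      omega)
  rw [Nat.even_iff] at this
  omega

/-- Two paths with the same ends and no edges between their interiors form a hole. -/
theorem IsBerge.even_of_two_paths (hB : G.IsBerge) {f g : ℕ → V} {n k : ℕ} (hf : G.IsPathSeq f n)
    (hg : G.IsPathSeq g k) (hn : 3 ≤ n) (hk : 2 ≤ k) (h0 : f 0 = g 0) (h1 : f n = g k)
    (hfg : ∀ i j, 0 < i → i < n → 0 < j → j < k → ¬ G.Adj (f i) (g j)) : Even (n + k) := by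
  refine hB.even_cycle (f := fun i => if i ≤ n then f i else g (n + k - i)) (by omega) ?_
  intro i j hij hj
  simp only
  split_ifs with hi hj' hj'
  · rw [hf i j hij hj']
    omega
  · rcases Nat.eq_zero_or_pos i with rfl | hi0
    · rw [h0, hg 0 _ (by omega) (by omega)]
      omega
    · rcases eq_or_lt_of_le hi with rfl | hin
      · rw [h1, G.adj_comm, hg _ k (by omega) le_rfl]
        omega
      · have := hfg i (n + k - j) hi0 hin (by omega) (by omega)
        simp only [this, false_iff]
        omega
  · omega
  · rw [G.adj_comm, hg _ _ (by omega) (by omega)]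
    omega

/-- The path `f` with a vertex added at either end. -/
theorem IsPathSeq.extend {f : ℕ → V} {n : ℕ} (hf : G.IsPathSeq f n) {x y : V}
    (hx : ∀ i ≤ n, G.Adj x (f i) ↔ i = 0) (hy : ∀ i ≤ n, G.Adj y (f i) ↔ i = n)
    (hxy : ¬ G.Adj x y) :
    G.IsPathSeq (fun i => if i = 0 then x else if i ≤ n + 1 then f (i - 1) else y) (n + 2) := by
  intro i j hij hj
  simp only
  rw [if_neg (show ¬ j = 0 by omega)]
  split_ifs with h1 h2 h2 h3
  · rw [hx _ (by omega)]
    omega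
  · simp only [hxy, false_iff]
    omega
  · rw [hf _ _ (by omega) (by omega)]
    omega
  · rw [G.adj_comm, hy _ (by omega)]
    omega
  · omega
  · omega

theorem even_of_leap {f : ℕ → V} {n : ℕ} (hf : G.IsPathSeq f n) {x y : V} {X Y : Set V}
    (hx : ∀ i ≤ n, G.Adj x (f i) ↔ i = 0) (hy : ∀ i ≤ n, G.Adj y (f i) ↔ i = n)
    (hxy : ¬ G.Adj x y) (hn : 0 < n) (hfX : ∀ i ≤ n, f i ∈ X) (hxY : x ∈ Y) (hyY : y ∈ Y)
    (hXY : ¬ G.IsPathPair X Y) : Even n := by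
  by_contra hodd
  rw [Nat.not_even_iff_odd, Nat.odd_iff] at hodd
  have hp := (hf.extend hx hy hxy).hasInducedPath (X := X) (by omega) (by
    intro i hi hin
    rw [if_neg (by omega), if_pos (by omega)]
    exact hfX _ (by omega))
  rw [if_pos rfl, if_neg (by omega), if_neg (by omega)] at hp
  exact hXY ⟨x, hxY, y, hyY, hxy, n + 2, Nat.odd_iff.2 (by omega), hp⟩

/-- Two adjacent vertices, each adjacent to exactly one end of a path, close a hole. -/
theorem IsBerge.odd_of_cap (hB : G.IsBerge) {f : ℕ → V} {n : ℕ} (hf : G.IsPathSeq f n) {x y : V}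
    (hx : ∀ i ≤ n, G.Adj x (f i) ↔ i = 0) (hy : ∀ i ≤ n, G.Adj y (f i) ↔ i = n)
    (hxy : G.Adj x y) (hn : 0 < n) : Odd n := by
  by_contra heven
  rw [Nat.not_odd_iff_even, Nat.even_iff] at heven
  have := hB.even_cycle (f := fun i => if i ≤ n then f i else if i = n + 1 then y else x)
    (n := n + 3) (by omega) (by
    intro i j hij hj
    simp only
    split_ifs with h1 h2 h3 h2 h3 h4 <;> first
      | omega
      | rw [hf _ _ hij (by omega)]; omega
      | rw [G.adj_comm, hy _ (by omega)]; omega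
      | rw [G.adj_comm, hx _ (by omega)]; omega
      | simp only [hxy.symm, true_iff]; omega)
  rw [Nat.even_iff] at this
  omega

/-- A shortest walk from `u` to `w` through `C` is induced, since a chord would shorten it. -/
theorem IsConnectedSet.exists_isPathSeq {C : Set V} (hC : G.IsConnectedSet C) {u w a b : V}
    (ha : a ∈ C) (hb : b ∈ C) (hua : G.Adj u a) (hwb : G.Adj w b) (hne : u ≠ w)
    (huw : ¬ G.Adj u w) :
    ∃ f n, 2 ≤ n ∧ G.IsPathSeq f n ∧ f 0 = u ∧ f n = w ∧ ∀ i, 0 < i → i < n → f i ∈ C := by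
  classical
  have hex : ∃ n, ∃ f : ℕ → V, f 0 = u ∧ f n = w ∧ (∀ i < n, G.Adj (f i) (f (i + 1))) ∧
      ∀ i, 0 < i → i < n → f i ∈ C := by
    obtain ⟨p⟩ := hC ⟨a, ha⟩ ⟨b, hb⟩
    refine ⟨p.length + 2, fun i => if i = 0 then u else if i ≤ p.length + 1 then
      (p.getVert (i - 1)).1 else w, by simp, by simp, fun i hi => ?_, fun i hi hin => ?_⟩
    · simp only
      rw [if_neg (show ¬ i + 1 = 0 by omega)]
      split_ifs with h1 h2 h2
      · subst h1
        simpa using hua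
      · omega
      · have := p.adj_getVert_succ (i := i - 1) (by omega)
        rw [show i - 1 + 1 = i by omega] at this
        exact this
      · have : i - 1 = p.length := by omega
        rw [this, p.getVert_length]
        exact hwb.symm
      · omega
      · omega
    · simp only
      rw [if_neg (by omega), if_pos (by omega)]
      exact Subtype.prop _
  obtain ⟨f, h0, h1, hadj, hfC⟩ := Nat.find_spec hex
  set n := Nat.find hex with hn
  have hn2 : 2 ≤ n := by
    by_contra hlt
    have : n = 0 ∨ n = 1 := by omega
    rcases this with h | h
    · rw [h] at h1
      exact hne (h0.symm.trans h1)
    · rw [h] at h1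
      have := hadj 0 (by omega)
      rw [h0, zero_add, h1] at this
      exact huw this
  refine ⟨f, n, hn2, fun i j hij hj => ⟨fun hij' => ?_, ?_⟩, h0, h1, hfC⟩
  · by_contra hne'
    refine Nat.find_min hex (m := n - (j - i - 1)) (by omega)
      ⟨fun t => if t ≤ i then f t else f (t + (j - i - 1)), by simpa using h0, ?_,
        fun t ht => ?_, fun t ht htn => ?_⟩
    · simp only
      rw [if_neg (by omega), show n - (j - i - 1) + (j - i - 1) = n by omega, h1]
    · simp only
      split_ifs with h2 h3 h3
      · exact hadj t (by omega)
      · obtain rfl : t = i := by omega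
        rwa [show t + 1 + (j - t - 1) = j by omega]
      · omega
      · rw [show t + 1 + (j - i - 1) = t + (j - i - 1) + 1 by omega]
        exact hadj _ (by omega)
    · simp only
      split_ifs with h2
      · exact hfC t ht (by omega)
      · exact hfC _ (by omega) (by omega)
  · rintro rfl
    exact hadj i (by omega)

/-- The adjacencies between a path with interior in `C` and an antipath with interior in `D`. -/
theorem IsBerge.isPathAntipathMatrix (hB : G.IsBerge) {p q : ℕ → V} {L M : ℕ}
    (hp : G.IsPathSeq p L) (hq : Gᶜ.IsPathSeq q M) (hL : 3 ≤ L) {C D : Set V}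
    (hpC : ∀ i, 0 < i → i < L → p i ∈ C) (hqD : ∀ j, 0 < j → j < M → q j ∈ D)
    (hleft : ∀ j, 0 < j → j < M → G.Adj (p 0) (q j))
    (hright : ∀ j, 0 < j → j < M → G.Adj (p L) (q j))
    (hbot : ∀ i, 0 < i → i < L → ¬ G.Adj (p i) (q 0))
    (htop : ∀ i, 0 < i → i < L → ¬ G.Adj (p i) (q M))
    (hne : ∀ i j, 0 < i → i < L → j ≤ M → p i ≠ q j)
    (hnp : ¬ G.IsPathPair C D) (hna : ¬ G.IsAntipathPair C D) :
    IsPathAntipathMatrix (fun i j => G.Adj (p i) (q j)) L M := by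
  have hqn : ∀ j, j + 1 ≤ M → ¬ G.Adj (q j) (q (j + 1)) := fun j hj =>
    ((compl_adj ..).1 ((hq j (j + 1) (by omega) hj).2 rfl)).2
  have hna' : ¬ Gᶜ.IsPathPair D C := fun h => hna (isPathPair_compl.1 h)
  have hpc : ∀ i j, i + 2 ≤ j → j ≤ L → Gᶜ.Adj (p i) (p j) := fun i j hij hj =>
    (compl_adj ..).2 ⟨hp.ne hL (by omega) hj, fun h => by
      have := (hp i j (by omega) hj).1 h
      omega⟩
  have hpn : ∀ i, i + 1 ≤ L → ¬ Gᶜ.Adj (p i) (p (i + 1)) := fun i hi h =>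
    ((compl_adj ..).1 h).2 ((hp i (i + 1) (by omega) hi).2 rfl)
  have hcompl : ∀ i j, 0 < i → i < L → j ≤ M → (Gᶜ.Adj (p i) (q j) ↔ ¬ G.Adj (p i) (q j)) :=
    fun i j hi hiL hj => by simp [compl_adj, hne i j hi hiL hj]
  have first : ∀ a c d, 0 < a → a < L → d < M → (∀ j, c ≤ j → j ≤ d → (G.Adj (p a) (q j) ↔ j ≠ c)) →
      ∀ i ≤ d - c, c < d → (Gᶜ.Adj (p a) (q (c + i)) ↔ i = 0) := by
    intro a c d ha haL hd h i hi hcd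
    rw [hcompl a _ ha haL (by omega), h _ (by omega) (by omega)]
    omega
  have last : ∀ a c d, 0 < a → a < L → d < M → (∀ j, c ≤ j → j ≤ d → (G.Adj (p a) (q j) ↔ j ≠ d)) →
      ∀ i ≤ d - c, c < d → (Gᶜ.Adj (p a) (q (c + i)) ↔ i = d - c) := by
    intro a c d ha haL hd h i hi hcd
    rw [hcompl a _ ha haL (by omega), h _ (by omega) (by omega)]
    omega
  -- In the complement, `p x`, then `q c, …, q d`, then `p y` is a path, closed to a hole by the
  -- adjacent vertices `p u` and `p w`.
  have short : ∀ s c d x y u w, s + 3 ≤ L → c < d → d < M →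
      (∀ i ≤ d - c, Gᶜ.Adj (p x) (q (c + i)) ↔ i = 0) →
      (∀ i ≤ d - c, Gᶜ.Adj (p y) (q (c + i)) ↔ i = d - c) → ¬ Gᶜ.Adj (p x) (p y) →
      (∀ j, c ≤ j → j ≤ d → G.Adj (p u) (q j) ∧ G.Adj (p w) (q j)) →
      Gᶜ.Adj (p w) (p x) → ¬ Gᶜ.Adj (p w) (p y) → Gᶜ.Adj (p u) (p y) → ¬ Gᶜ.Adj (p u) (p x) →
      Gᶜ.Adj (p w) (p u) → Odd (d - c) := by
    intro s c d x y u w hs hcd hd hx hy hxy huw hwx hwy huy hux hwu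
    have hn : ∀ i ≤ d - c, ¬ Gᶜ.Adj (p u) (q (c + i)) ∧ ¬ Gᶜ.Adj (p w) (q (c + i)) := fun i hi =>
      ⟨fun h => ((compl_adj ..).1 h).2 (huw _ (by omega) (by omega)).1,
        fun h => ((compl_adj ..).1 h).2 (huw _ (by omega) (by omega)).2⟩
    have hext := (hq.shift (s := c) (t := d) hd.le).extend hx hy hxy
    have := hB.compl.odd_of_cap hext (x := p w) (y := p u) (by
      intro i hi
      split_ifs with h1 h2
      · simp [hwx, h1]
      · simp [(hn (i - 1) (by omega)).2, h1]
      · simp [hwy, h1]) (by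
      intro i hi
      split_ifs with h1 h2
      · simp only [hux, false_iff]
        omega
      · simp only [(hn (i - 1) (by omega)).1, false_iff]
        omega
      · simp only [huy, true_iff]
        omega) hwu (by omega)
    rw [Nat.odd_iff] at this ⊢
    omega
  refine ⟨hleft, hright, hbot, htop, ?_, ?_, ?_, ?_, ?_, ?_, ?_, ?_⟩
  · intro j s t hj hjM hst ht hs' ht' hgap
    refine hB.even_of_fan (hp.shift (s := s) ht) (v := q j) (by omega) fun i hi => ?_
    by_cases h0 : i = 0
    · subst h0
      simpa using hs'
    by_cases h1 : i = t - s
    · rw [h1, show s + (t - s) = t by omega]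
      simpa using ht'
    · have := hgap (s + i) (by omega) (by omega)
      simp [this, h0, h1]
  · intro i c d hi hiL hcd hd hc' hd' hgap
    refine hB.compl.even_of_fan (hq.shift (s := c) hd) (v := p i) (by omega) fun j hj => ?_
    rw [Gᶜ.adj_comm, hcompl i _ hi hiL (by omega)]
    by_cases h0 : j = 0
    · subst h0
      simpa using hc'
    by_cases h1 : j = d - c
    · rw [h1, show c + (d - c) = d by omega]
      simpa using hd'
    · have := hgap (c + j) (by omega) (by omega)
      simp [this, h0, h1]
  · intro j s t hj hjM hs hst ht h
    refine even_of_leap (hp.shift (s := s) (t := t) ht.le) (x := q j) (y := q (j + 1)) (X := C)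
      (Y := D) ?_ ?_ (hqn j (by omega)) (by omega) ?_ (hqD _ (by omega) (by omega))
      (hqD _ (by omega) (by omega)) hnp
    · intro i hi
      rw [G.adj_comm, (h (s + i) (by omega) (by omega)).1]
      omega
    · intro i hi
      rw [G.adj_comm, (h (s + i) (by omega) (by omega)).2]
      omega
    · exact fun i hi => hpC _ (by omega) (by omega)
  · intro j s t hj hjM hs hst ht h
    refine even_of_leap (hp.shift (s := s) (t := t) ht.le) (x := q (j + 1)) (y := q j) (X := C)
      (Y := D) ?_ ?_ (fun h => hqn j (by omega) h.symm) (by omega) ?_ (hqD _ (by omega) (by omega))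
      (hqD _ (by omega) (by omega)) hnp
    · intro i hi
      rw [G.adj_comm, (h (s + i) (by omega) (by omega)).1]
      omega
    · intro i hi
      rw [G.adj_comm, (h (s + i) (by omega) (by omega)).2]
      omega
    · exact fun i hi => hpC _ (by omega) (by omega)
  · intro a b c d ha haL hb hbL hab hc hcd hd h
    refine hB.compl.odd_of_cap (hq.shift (s := c) (t := d) hd.le) (x := p a) (y := p b)
      (fun i hi => first a c d ha haL hd (fun j h1 h2 => (h j h1 h2).1) i hi hcd)
      (fun i hi => last b c d hb hbL hd (fun j h1 h2 => (h j h1 h2).2) i hi hcd) ?_ (by omega)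
    rcases hab with hab | hab
    · exact hpc a b hab hbL.le
    · exact (hpc b a hab haL.le).symm
  · intro a b c d ha haL hb hbL hab hc hcd hd h
    refine even_of_leap (hq.shift (s := c) (t := d) hd.le) (x := p a) (y := p b)
      (fun i hi => first a c d ha haL hd (fun j h1 h2 => (h j h1 h2).1) i hi hcd)
      (fun i hi => last b c d hb hbL hd (fun j h1 h2 => (h j h1 h2).2) i hi hcd) ?_ (by omega)
      (fun i hi => hqD _ (by omega) (by omega)) (hpC a ha haL) (hpC b hb hbL) hna'
    rcases hab with rfl | rfl
    · exact hpn a hbL.le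
    · exact fun h => hpn b haL.le h.symm
  · intro s c d hs hc hcd hd h
    exact short s c d (s + 1) (s + 2) s (s + 3) hs hcd hd
      (fun i hi => first _ c d (by omega) (by omega) hd (fun j h1 h2 => (h j h1 h2).2.2.1) i hi hcd)
      (fun i hi => last _ c d (by omega) (by omega) hd (fun j h1 h2 => (h j h1 h2).2.2.2) i hi hcd)
      (hpn (s + 1) (by omega)) (fun j h1 h2 => ⟨(h j h1 h2).1, (h j h1 h2).2.1⟩)
      (hpc (s + 1) (s + 3) (by omega) hs).symm (fun h => hpn (s + 2) hs h.symm)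
      (hpc s (s + 2) (by omega) (by omega)) (hpn s (by omega)) (hpc s (s + 3) (by omega) hs).symm
  · intro s c d hs hc hcd hd h
    exact short s c d (s + 2) (s + 1) (s + 3) s hs hcd hd
      (fun i hi => first _ c d (by omega) (by omega) hd (fun j h1 h2 => (h j h1 h2).2.2.1) i hi hcd)
      (fun i hi => last _ c d (by omega) (by omega) hd (fun j h1 h2 => (h j h1 h2).2.2.2) i hi hcd)
      (fun h => hpn (s + 1) (by omega) h.symm) (fun j h1 h2 => ⟨(h j h1 h2).2.1, (h j h1 h2).1⟩)
      (hpc s (s + 2) (by omega) (by omega)) (hpn s (by omega))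
      (hpc (s + 1) (s + 3) (by omega) hs).symm (fun h => hpn (s + 2) hs h.symm)
      (hpc s (s + 3) (by omega) hs)

/-- A skew partition `(A, B)` with a component `C` of `A` and an anticomponent `D` of `B`, and a
vertex `v` anticomplete to `C` and complete to `D`. -/
structure IsLooseAt (G : SimpleGraph V) (A B C D : Set V) (v : V) : Prop where
  skew : G.IsSkewPartition A B
  comp : G.IsComponent A C
  anticomp : G.IsAnticomponent B D
  notMem_left : v ∉ C
  notMem_right : v ∉ D
  anticomplete : ∀ a ∈ C, ¬ G.Adj v a
  complete : ∀ b ∈ D, G.Adj v b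

theorem IsLooseAt.compl {A B C D : Set V} {v : V} (h : G.IsLooseAt A B C D v) :
    Gᶜ.IsLooseAt B A D C v where
  skew := h.skew.compl
  comp := h.anticomp
  anticomp := isAnticomponent_compl.2 h.comp
  notMem_left := h.notMem_right
  notMem_right := h.notMem_left
  anticomplete := fun a ha hadj => ((compl_adj ..).1 hadj).2 (h.complete a ha)
  complete := fun b hb => (compl_adj ..).2
    ⟨fun hvb => h.notMem_left (hvb ▸ hb), h.anticomplete b hb⟩

/-- The vertex `v` sees the two ends of such an odd path and nothing of its interior, so it would
close an odd hole. -/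
theorem IsLooseAt.not_isPathPair {A B C D : Set V} {v : V} (h : G.IsLooseAt A B C D v)
    (hB : G.IsBerge) : ¬ G.IsPathPair C D := by
  rintro ⟨u, hu, w, hw, huw, n, hn, hp⟩
  obtain ⟨f, hf, rfl, rfl, hfC⟩ := hp.exists_isPathSeq
  have hn3 := hf.three_le hn huw
  refine Nat.not_even_iff_odd.2 hn (hB.even_of_fan hf (by omega) (v := v) fun i hi => ?_)
  rw [G.adj_comm]
  by_cases h0 : i = 0
  · subst h0
    simpa using h.complete _ hu
  by_cases h1 : i = n
  · subst h1
    simpa using h.complete _ hw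
  · simpa [h0, h1] using h.anticomplete _ (hfC i (by omega) (by omega))

theorem IsLooseAt.not_isAntipathPair {A B C D : Set V} {v : V} (h : G.IsLooseAt A B C D v)
    (hB : G.IsBerge) : ¬ G.IsAntipathPair C D := by
  rw [← isPathPair_compl]
  exact h.compl.not_isPathPair hB.compl

/-- The ends of an odd path through `C'` are also joined by an induced path through `C`. Together
they form a hole, so the second path is odd too and makes `C`, `D` a path pair. -/
theorem IsLooseAt.not_isPathPair_of_ne {A B C D C' : Set V} {v : V} (h : G.IsLooseAt A B C D v)
    (hB : G.IsBerge) (hC' : G.IsComponent A C') (hne : C' ≠ C)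
    (hD : ∀ u ∈ D, ∃ a ∈ C, G.Adj u a) : ¬ G.IsPathPair C' D := by
  rintro ⟨u, hu, w, hw, huw, n, hn, hp⟩
  have huw' := hp.ne hn
  obtain ⟨f, hf, rfl, rfl, hfC⟩ := hp.exists_isPathSeq
  have hn3 := hf.three_le hn huw
  obtain ⟨a, ha, hua⟩ := hD _ hu
  obtain ⟨b, hb, hwb⟩ := hD _ hw
  obtain ⟨-, -, hCc, -⟩ := isComponent_iff.1 h.comp
  obtain ⟨g, k, hk, hg, hg0, hgk, hgC⟩ := hCc.exists_isPathSeq ha hb hua hwb huw' huw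
  have hev := hB.even_of_two_paths hf hg hn3 hk hg0.symm hgk.symm fun i j hi hin hj hjk =>
    (hC'.ne_and_not_adj h.comp hne _ (hfC i hi hin) _ (hgC j hj hjk)).2
  have hkodd : Odd k := by
    rw [Nat.even_iff] at hev
    rw [Nat.odd_iff] at hn ⊢
    omega
  rw [← hg0] at hu
  rw [← hgk] at hw
  exact h.not_isPathPair hB ⟨_, hu, _, hw, by rwa [hg0, hgk], k, hkodd,
    hg.hasInducedPath (hg.three_le hkodd (by rwa [hg0, hgk])) hgC⟩

theorem IsLooseAt.not_isAntipathPair_of_ne {A B C D D' : Set V} {v : V}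
    (h : G.IsLooseAt A B C D v) (hB : G.IsBerge) (hD' : G.IsAnticomponent B D') (hne : D' ≠ D)
    (hC : ∀ u ∈ C, ∃ b ∈ D, ¬ G.Adj u b) : ¬ G.IsAntipathPair C D' := by
  rw [← isPathPair_compl]
  refine h.compl.not_isPathPair_of_ne hB.compl hD' hne fun u hu => ?_
  obtain ⟨b, hb, hub⟩ := hC u hu
  refine ⟨b, hb, (compl_adj ..).2 ⟨?_, hub⟩⟩
  rintro rfl
  exact Set.disjoint_left.1 h.skew.1 ((isComponent_iff.1 h.comp).1 hu)
    ((isComponent_iff.1 h.anticomp).1 hb)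

/-- Any vertex of `D` without a neighbour in `C` can be moved to the other side. -/
theorem IsLooseAt.exists_smaller [Fintype V] {A B C D : Set V} {v : V}
    (h : G.IsLooseAt A B C D v) (hG : G.IsMinimumImperfect) {u : V} (hu : u ∈ D)
    (huC : ∀ a ∈ C, ¬ G.Adj u a) :
    ∃ A' B' D', G.IsLooseAt A' B' C D' v ∧ D'.ncard < D.ncard := by
  obtain ⟨hdis, hU, hA, hB⟩ := h.skew
  obtain ⟨hCA, hCne, hCc, hCsep⟩ := isComponent_iff.1 h.comp
  obtain ⟨hDB, hDne, hDc, hDsep⟩ := isComponent_iff.1 h.anticomp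
  obtain ⟨a, haA, haC⟩ := h.comp.sdiff_nonempty hA
  obtain ⟨b, hbB, hbD⟩ := IsComponent.sdiff_nonempty h.anticomp hB
  by_cases hsing : (D \ {u}).Nonempty
  swap
  · exfalso
    have hDu : ∀ w ∈ D, w = u := by
      intro w hw
      by_contra hwu
      exact hsing ⟨w, hw, hwu⟩
    -- If `D = {u}`, then `u` is adjacent to all the rest of `B`.
    refine hG.no_star_cutset (A₁ := C) (A₂ := A \ C) (B := B) ?_ ?_ hCne ⟨a, haA, haC⟩
      (hdis.mono_left hCA) (hdis.mono_left Set.sdiff_subset) (hDB hu) ?_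
    · rw [Set.union_sdiff_cancel hCA, hU]
    · exact fun x hx y hy => ⟨fun h => hy.2 (h ▸ hx), hCsep x hx y hy.1 hy.2⟩
    · intro w hw hwu
      by_contra hnadj
      exact hDsep u hu w hw (fun hwD => hwu (hDu w hwD)) ((compl_adj ..).2 ⟨hwu.symm, hnadj⟩)
  · obtain ⟨x, hx⟩ := hsing
    obtain ⟨D', hD', hxD'⟩ := exists_isComponent_mem (G := Gᶜ) hx
    obtain ⟨hD'D, hD'ne, hD'c, hD'sep⟩ := isComponent_iff.1 hD'
    have huA : u ∉ A := fun huA => Set.disjoint_left.1 hdis huA (hDB hu)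
    have hcomp : G.IsComponent (insert u A) C := by
      refine isComponent_iff.2 ⟨hCA.trans (Set.subset_insert u A), hCne, hCc, ?_⟩
      rintro c hc y (rfl | hy) hyC
      · exact fun hadj => huC c hc hadj.symm
      · exact hCsep c hc y hy hyC
    have hanti : G.IsAnticomponent (B \ {u}) D' := by
      refine isComponent_iff.2 ⟨fun y hy => ⟨hDB (hD'D hy).1, (hD'D hy).2⟩, hD'ne, hD'c, ?_⟩
      intro c hc y hy hyD'
      by_cases hyD : y ∈ D
      · exact hD'sep c hc y ⟨hyD, hy.2⟩ hyD'
      · exact hDsep c (hD'D hc).1 y hy.1 hyD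
    refine ⟨insert u A, B \ {u}, D', ⟨⟨?_, ?_, ?_, ?_⟩, hcomp, hanti, h.notMem_left,
      fun hv => h.notMem_right (hD'D hv).1, h.anticomplete,
      fun y hy => h.complete y (hD'D hy).1⟩, ?_⟩
    · rw [Set.disjoint_left]
      rintro y (rfl | hy) hy'
      · exact hy'.2 rfl
      · exact Set.disjoint_left.1 hdis hy hy'.1
    · rw [Set.eq_univ_iff_forall] at hU ⊢
      intro y
      by_cases hyu : y = u
      · exact Or.inl (Or.inl hyu)
      · exact (hU y).imp Or.inr fun hy => ⟨hy, hyu⟩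
    · exact hcomp.not_isConnectedSet ⟨a, Or.inr haA, haC⟩
    · refine IsComponent.not_isConnectedSet hanti ⟨b, ⟨hbB, ?_⟩, fun hbD' => hbD (hD'D hbD').1⟩
      rintro rfl
      exact hbD hu
    · exact Set.ncard_lt_ncard ⟨fun y hy => (hD'D hy).1, fun hsub => (hD'D (hsub hu)).2 rfl⟩

theorem IsMinimumImperfect.not_isLooseAt [Fintype V] (hG : G.IsMinimumImperfect)
    {A B C D : Set V} {v : V} (h : G.IsLooseAt A B C D v) : False := by
  induction hN : C.ncard + D.ncard using Nat.strong_induction_on generalizing A B C D with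
  | _ N ih =>
  by_cases hD : ∃ u ∈ D, ∀ a ∈ C, ¬ G.Adj u a
  · obtain ⟨u, hu, huC⟩ := hD
    obtain ⟨A', B', D', h', hlt⟩ := h.exists_smaller hG hu huC
    exact ih _ (by omega) h' rfl
  by_cases hC : ∃ u ∈ C, ∀ b ∈ D, G.Adj u b
  · obtain ⟨u, hu, huD⟩ := hC
    obtain ⟨B', A', C', h', hlt⟩ := h.compl.exists_smaller hG.compl hu
      fun b hb hadj => ((compl_adj ..).1 hadj).2 (huD b hb)
    have h'' := h'.compl
    rw [compl_compl] at h''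
    exact ih _ (by omega) h'' rfl
  push Not at hC hD
  have hB := hG.1
  have hnp := h.not_isPathPair hB
  have hna := h.not_isAntipathPair hB
  obtain ⟨D', hD', hCD'⟩ := hG.exists_pair_of_isComponent h.skew h.comp
  obtain ⟨C', hC', hC'D⟩ := hG.exists_pair_of_isAnticomponent h.skew h.anticomp
  have hDne : D' ≠ D := by
    rintro rfl
    exact hCD'.elim hnp hna
  have hCne : C' ≠ C := by
    rintro rfl
    exact hC'D.elim hnp hna
  -- What survives is a path pair for `C` with another anticomponent `D'`, and an antipath pair for
  -- `D` with another component `C'`.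
  obtain ⟨u, hu, w, hw, huw, L, hL, hpath⟩ :=
    hCD'.resolve_right (h.not_isAntipathPair_of_ne hB hD' hDne hC)
  obtain ⟨x, hx, y, hy, hxy, M, hM, hanti⟩ :=
    hC'D.resolve_left (h.not_isPathPair_of_ne hB hC' hCne hD)
  obtain ⟨p, hp, rfl, rfl, hpC⟩ := hpath.exists_isPathSeq
  obtain ⟨q, hq, rfl, rfl, hqD⟩ := HasInducedPath.exists_isPathSeq hanti
  have hL3 := hp.three_le hL huw
  have hM3 := hq.three_le hM fun hadj => ((compl_adj ..).1 hadj).2 hxy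
  have hcomplete : ∀ s ∈ D', ∀ t ∈ D, G.Adj s t := by
    intro s hs t ht
    obtain ⟨hst, hadj⟩ := IsComponent.ne_and_not_adj hD' h.anticomp hDne s hs t ht
    by_contra hnadj
    exact hadj ((compl_adj ..).2 ⟨hst, hnadj⟩)
  have hCC' := h.comp.ne_and_not_adj hC' hCne.symm
  have hCA := (isComponent_iff.1 h.comp).1
  have hDB := (isComponent_iff.1 h.anticomp).1
  refine (hB.isPathAntipathMatrix hp hq hL3 hpC hqD (fun j hj hjM => hcomplete _ hu _ (hqD j hj hjM))
    (fun j hj hjM => hcomplete _ hw _ (hqD j hj hjM)) (fun i hi hiL => (hCC' _ (hpC i hi hiL) _ hx).2)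
    (fun i hi hiL => (hCC' _ (hpC i hi hiL) _ hy).2) (fun i j hi hiL hj => ?_) hnp hna).not_odd
    hL hL3 hM hM3
  rcases Nat.eq_zero_or_pos j with rfl | hj0
  · exact (hCC' _ (hpC i hi hiL) _ hx).1
  rcases eq_or_lt_of_le hj with rfl | hjM
  · exact (hCC' _ (hpC i hi hiL) _ hy).1
  · intro heq
    exact Set.disjoint_left.1 h.skew.1 (hCA (hpC i hi hiL)) (heq ▸ hDB (hqD j hj0 hjM))

/-- A skew partition with a vertex of `B` anticomplete to a component of `A`. -/
theorem IsSkewPartition.exists_isLooseAt [Finite V] {A B C : Set V} {v : V}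
    (h : G.IsSkewPartition A B) (hC : G.IsComponent A C) (hv : v ∈ B)
    (hvC : ∀ a ∈ C, ¬ G.Adj v a) : ∃ D, G.IsLooseAt A B C D v := by
  obtain ⟨D₀, hD₀, hvD₀⟩ := exists_isComponent_mem (G := Gᶜ) hv
  obtain ⟨b, hbB, hbD₀⟩ := hD₀.sdiff_nonempty h.2.2.2
  obtain ⟨D, hD, hbD⟩ := exists_isComponent_mem (G := Gᶜ) hbB
  have hne : D₀ ≠ D := by
    rintro rfl
    exact hbD₀ hbD
  have hsep := hD₀.ne_and_not_adj hD hne v hvD₀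
  refine ⟨D, h, hC, hD, fun hvC' => ?_, fun hvD => (hsep v hvD).1 rfl, hvC, fun t ht => ?_⟩
  · exact Set.disjoint_left.1 h.1 ((isComponent_iff.1 hC).1 hvC') hv
  · by_contra hnadj
    exact (hsep t ht).2 ((compl_adj ..).2 ⟨(hsep t ht).1, hnadj⟩)

theorem IsMinimumImperfect.not_isLoosePair [Fintype V] (hG : G.IsMinimumImperfect)
    {A B : Set V} (hAB : G.IsSkewPartition A B) : ¬ G.IsLoosePair A B := by
  rintro (⟨b, hb, C, hC, hbC⟩ | ⟨a, ha, D, hD, haD⟩)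
  · obtain ⟨D, hD⟩ := hAB.exists_isLooseAt hC hb hbC
    exact hG.not_isLooseAt hD
  · obtain ⟨D', hD'⟩ := hAB.compl.exists_isLooseAt hD ha
      fun b hb hadj => ((compl_adj ..).1 hadj).2 (haD b hb)
    exact hG.compl.not_isLooseAt hD'

end LoosePartitions

end SimpleGraph

theorem mainTheorem3 {V : Type*} [Fintype V] (G : SimpleGraph V) (hG : G.IsMinimumImperfect) :
    (∀ A B : Set V, G.IsSkewPartition A B →
      (∀ C : Set V, G.IsComponent A C →
        ∃ D : Set V, G.IsAnticomponent B D ∧ (G.IsPathPair C D ∨ G.IsAntipathPair C D)) ∧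
      (∀ D : Set V, G.IsAnticomponent B D →
        ∃ C : Set V, G.IsComponent A C ∧ (G.IsPathPair C D ∨ G.IsAntipathPair C D))) ∧
    (¬ ∃ A B : Set V, G.IsSkewPartition A B ∧ G.IsBalancedPair A B) ∧
    (¬ ∃ A B : Set V, G.IsSkewPartition A B ∧ G.IsLoosePair A B) := by
  refine ⟨fun A B hAB => ⟨fun C hC => hG.exists_pair_of_isComponent hAB hC,
    fun D hD => hG.exists_pair_of_isAnticomponent hAB hD⟩, ?_, ?_⟩
  · rintro ⟨A, B, hAB, hbal⟩
    exact hG.not_isBalancedPair hAB hbal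
  · rintro ⟨A, B, hAB, hloose⟩
    exact hG.not_isLoosePair hAB hloose
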